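/- Let $F$ be a non-Archimedean local field with ring of integers $\mathcal O$, maximal ideal $\mathcal P$, residue field of cardinality $q$, uniformizer $\varpi$, and normalized absolute value $\|\cdot\|$ (so $\|\varpi\|=q^{-1}$). Let $G=\mathrm{PGL}(2,F)$, let $dg$ be a Haar measure on $G$, and let $t\in G$ be the image of $\mathrm{diag}(1,\varpi)$. Let $x:\mathcal O^\times\to\mathbb C^\times$ be a continuous character with $x^2\neq 1$. Let $d=d(x)\ge 0$ be the least integer $r$ such that $x^2$ is trivial on $U_r$, where $U_0=\mathcal O^\times$ and $U_r=1+\mathcal P^r$ for $r>0$ (so $d>0$). Let $\Gamma_d\subset G$ be the image of $\{\gamma\in \mathrm{GL}(2,\mathcal O):\gamma_{21}\in\mathcal P^d\}$, with its character $\tilde x(\gamma)=x(\gamma_{11}^2/\det\gamma)$. Let $\mathcal H'_x$ be the algebra, under convolution, of the measures $\mu=f\,dg$ with $f:G\to\mathbb C$ locally constant and compactly supported such that $f(\gamma g)=f(g\gamma)=\tilde x(\gamma)f(g)$ for all $\gamma\in\Gamma_d$, $g\in G$; its unit is $\mu_0/\mathrm{vol}(\Gamma_d,dg)$, where for $n\in\mathbb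 Z$ we put $\mu_n=\phi_n\,dg$, with $\phi_n$ the (well-defined) function supported on $\Gamma_d t^n\Gamma_d$ such that $\phi_n(\gamma' t^n\gamma'')=\tilde x(\gamma'\gamma'')$ for $\gamma',\gamma''\in\Gamma_d$. Let $\Theta_x$ be the set of continuous characters $\theta:F^\times\to\mathbb C^\times$ with $\theta|_{\mathcal O^\times}=x$; the map $\theta\mapsto z=\theta(\varpi)$ is a bijection $\Theta_x\to\mathbb C^\times$, by which the algebra $\mathbb C[\Theta_x]$ of regular functions on $\Theta_x$ is identified with $\mathbb C[z,z^{-1}]$. For $\theta\in\Theta_x$ let $\pi_\theta$ be the representation of $G$ by left shifts, $(\pi_\theta(h)f)(g)=f(h^{-1}g)$, on the space $R_\theta$ of locally constant functions $f:G\to\mathbb C$ with $f(gb)=\theta(\bar b)\|\bar b\|^{1/2}f(g)$ for all $g\in G$ and all upper triangular $b$, where $\bar b=b_{11}/b_{22}$. For $\mu\in\mathcal H'_x$ the operator $\pi_\theta(\mu)=\int_G\pi_\theta(g)\,\mu(g)$ has finite rank; let $\hat\mu(\pi_\theta)$ be its trace. Then: (a) The map sending $\mu$ to the function $\theta\mapsto\hat\mu(\pi_\theta)$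 on $\Theta_x$ is an isomorphism of algebras $\mathcal H'_x\to\mathbb C[\Theta_x]=\mathbb C[z,z^{-1}]$. (b) For every $n\in\mathbb Z$ there is a constant $c\neq 0$, independent of $\theta$, such that $\hat\mu_n(\pi_\theta)=c\,z^n$ for all $\theta\in\Theta_x$, where $z=\theta(\varpi)$. (c) The family $(\mu_n)_{n\in\mathbb Z}$ is a basis of the complex vector space $\mathcal H'_x$. -/

import Mathlib

open scoped ValuativeRel MatrixGroups LaurentPolynomial
open MeasureTheory

noncomputable section

namespace PGL2Hecke

variable (F : Type*) [Field F] [ValuativeRel F] [TopologicalSpace F] [IsNonarchimedeanLocalField F]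

/-! ### The local field and its characters -/

/-- The inclusion of the units of the ring of integers into the multiplicative group of `F`. -/
def unitsIncl : 𝒪[F]ˣ →* Fˣ := Units.map (Subring.subtype 𝒪[F]).toMonoidHom

variable {F}

/-- The normalized valuation `Fˣ → ℤ`, of value `1` at every uniformizer. -/
def val (a : Fˣ) : ℤ :=
  -WithZero.log (IsNonarchimedeanLocalField.valueGroupWithZeroIsoInt F
    (ValuativeRel.valuation F (a : F)))

/-- The normalized absolute value `‖a‖ = q ^ (-val a)`, where `q` is the cardinality of the
residue field. -/
def normAbs (a : Fˣ) : ℝ := (Nat.card 𝓀[F] : ℝ) ^ (-val a)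

/-- The (continuous) characters `θ` of `Fˣ` whose restriction to the units of the ring of
integers is `x`. -/
def Theta (x : 𝒪[F]ˣ →ₜ* ℂˣ) : Type _ :=
  {θ : Fˣ →ₜ* ℂˣ // ∀ u : 𝒪[F]ˣ, θ (unitsIncl F u) = x u}

/-- The depth `d(x)`: the least `r ≥ 0` such that `x ^ 2` is trivial on `U_r`, where
`U_0` is the group of all units and `U_r = 1 + 𝓂 ^ r` for `r > 0`. -/
def depth (x : 𝒪[F]ˣ →ₜ* ℂˣ) : ℕ :=
  sInf {r : ℕ | ∀ u : 𝒪[F]ˣ, (u : 𝒪[F]) - 1 ∈ 𝓂[F] ^ r → x u ^ 2 = 1}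

open scoped Classical in
/-- A character of the units of the ring of integers, extended by `0` to `F`. -/
def extZero (x : 𝒪[F]ˣ →ₜ* ℂˣ) (a : F) : ℂ :=
  if h : ∃ u : 𝒪[F]ˣ, ((u : 𝒪[F]) : F) = a then (x h.choose : ℂ) else 0

/-- The unit of `F` given by a uniformizer. -/
def unif (ϖ : 𝒪[F]) (hϖ : Irreducible ϖ) : Fˣ :=
  Units.mk0 (ϖ : F) (by simpa using hϖ.ne_zero)

/-! ### The group `PGL(2, F)` and some of its subgroups -/

/-- The quotient topology. -/
instance : TopologicalSpace PGL(2, F) :=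
  inferInstanceAs (TopologicalSpace (GL (Fin 2) F ⧸ Subgroup.center (GL (Fin 2) F)))

instance : IsTopologicalGroup PGL(2, F) :=
  inferInstanceAs (IsTopologicalGroup (GL (Fin 2) F ⧸ Subgroup.center (GL (Fin 2) F)))

/-- The upper triangular matrix with diagonal `a, b` and upper right entry `u`. -/
def upperTri (a b : Fˣ) (u : F) : GL (Fin 2) F :=
  Matrix.GeneralLinearGroup.mkOfDetNeZero !![(a : F), u; 0, (b : F)] (by simp)

/-- The image in `PGL(2, F)` of the diagonal matrix with entries `1, ϖ`. -/
def tElt (ϖ : 𝒪[F]) (hϖ : Irreducible ϖ) : PGL(2, F) :=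
  Matrix.ProjGenLinGroup.mk (upperTri 1 (unif ϖ hϖ) 0)

/-- The natural map from `GL(2, 𝒪)` to `PGL(2, F)`. -/
def intToPGL : GL (Fin 2) 𝒪[F] →* PGL(2, F) :=
  Matrix.ProjGenLinGroup.mk.comp (Matrix.GeneralLinearGroup.map (Subring.subtype 𝒪[F]))

variable (F) in
/-- The subgroup of matrices in `GL(2, 𝒪)` whose lower left entry is in `𝓂 ^ d`. -/
def GammaTilde (d : ℕ) : Subgroup (GL (Fin 2) 𝒪[F]) where
  carrier := {γ | γ 1 0 ∈ 𝓂[F] ^ d}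
  one_mem' := by simp
  mul_mem' {a b} ha hb := by
    simp only [Set.mem_ofPred_eq, Units.val_mul, Matrix.mul_apply, Fin.sum_univ_two] at *
    exact Ideal.add_mem _ (Ideal.mul_mem_right _ _ ha) (Ideal.mul_mem_left _ _ hb)
  inv_mem' {a} ha := by
    simp only [Set.mem_ofPred_eq, Matrix.coe_units_inv, Matrix.inv_def, Matrix.adjugate_fin_two] at *
    simpa using (𝓂[F] ^ d).mul_mem_left (Ring.inverse (a : Matrix (Fin 2) (Fin 2) 𝒪[F]).det) ha

variable (F) in
/-- The subgroup `Γ_d` of `PGL(2, F)`. -/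
def Gamma (d : ℕ) : Subgroup PGL(2, F) := (GammaTilde F d).map intToPGL

/-- The function `g ↦ g₁₁² / det g` on `PGL(2, F)`, computed on any representative. -/
def ratio (g : PGL(2, F)) : F :=
  Quotient.liftOn' g (fun m : GL (Fin 2) F => m 0 0 ^ 2 / (m : Matrix (Fin 2) (Fin 2) F).det) (by
    intro a b hab
    obtain ⟨u, rfl⟩ := Matrix.ProjGenLinGroup.mk_eq_mk_iff.1
      (show Matrix.ProjGenLinGroup.mk a = Matrix.ProjGenLinGroup.mk b from Quotient.sound' hab)
    have hu : (u : F) ≠ 0 := u.ne_zero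
    simp only [Matrix.GeneralLinearGroup.coe_scalar, Units.val_mul, Matrix.det_mul,
      Matrix.scalar_apply, Matrix.mul_diagonal, Matrix.det_diagonal, Fin.prod_univ_two]
    field_simp)

/-- The character `γ ↦ x (γ₁₁² / det γ)` of `Γ_d`, `d = d(x) > 0`, given as a function on
`PGL(2, F)`; it is only ever evaluated on `Γ_d`, where `γ₁₁² / det γ` is a unit. -/
def xTilde (x : 𝒪[F]ˣ →ₜ* ℂˣ) (g : PGL(2, F)) : ℂ := extZero x (ratio g)

/-! ### The Hecke algebra -/

variable (F) in
/-- The locally constant compactly supported functions on `PGL(2, F)`; after the choice of a Haar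
measure `dg`, the map `f ↦ f dg` identifies them with the compactly supported smooth measures. -/
def testFun : Submodule ℂ (PGL(2, F) → ℂ) where
  carrier := {f | IsLocallyConstant f ∧ HasCompactSupport f}
  add_mem' {_ _} ha hb := ⟨ha.1.add hb.1, ha.2.add hb.2⟩
  zero_mem' := ⟨IsLocallyConstant.const 0, HasCompactSupport.zero⟩
  smul_mem' c _ hf := ⟨hf.1.comp (fun z => c • z), hf.2.smul_left (f := fun _ => c)⟩

/-- Convolution: `(f dg) ∗ (h dg) = (conv dg f h) dg`. -/
def conv [MeasurableSpace PGL(2, F)] (dg : Measure PGL(2, F)) (f h : PGL(2, F) → ℂ) :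
    PGL(2, F) → ℂ :=
  fun g => ∫ y, f y * h (y⁻¹ * g) ∂dg

/-- The (densities with respect to `dg` of the) compactly supported smooth measures on which left
and right translation by `γ ∈ Γ_d`, `d = d(x)`, are multiplication by `x̃(γ)`. -/
def heckeX (x : 𝒪[F]ˣ →ₜ* ℂˣ) : Submodule ℂ (PGL(2, F) → ℂ) where
  carrier := {f | f ∈ testFun F ∧ ∀ γ ∈ Gamma F (depth x), ∀ g,
    f (γ * g) = xTilde x γ * f g ∧ f (g * γ) = xTilde x γ * f g}
  add_mem' {a b} ha hb := by
    refine ⟨add_mem ha.1 hb.1, fun γ hγ g => ⟨?_, ?_⟩⟩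
    · simp only [Pi.add_apply, (ha.2 γ hγ g).1, (hb.2 γ hγ g).1]; ring
    · simp only [Pi.add_apply, (ha.2 γ hγ g).2, (hb.2 γ hγ g).2]; ring
  zero_mem' := ⟨zero_mem _, by simp⟩
  smul_mem' c f hf := by
    refine ⟨Submodule.smul_mem _ c hf.1, fun γ hγ g => ⟨?_, ?_⟩⟩
    · simp only [Pi.smul_apply, smul_eq_mul, (hf.2 γ hγ g).1]; ring
    · simp only [Pi.smul_apply, smul_eq_mul, (hf.2 γ hγ g).2]; ring

lemma heckeX_le (x : 𝒪[F]ˣ →ₜ* ℂˣ) : heckeX x ≤ testFun F := fun _ h => h.1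

open scoped Classical in
/-- The function `φ_n` supported on the double coset `Γ_d tⁿ Γ_d`, with
`φ_n (γ' tⁿ γ'') = x̃ (γ' γ'')` there. -/
def phi (x : 𝒪[F]ˣ →ₜ* ℂˣ) (ϖ : 𝒪[F]) (hϖ : Irreducible ϖ) (n : ℤ) (g : PGL(2, F)) : ℂ :=
  if h : ∃ p : Gamma F (depth x) × Gamma F (depth x),
      g = (p.1 : PGL(2, F)) * tElt ϖ hϖ ^ n * (p.2 : PGL(2, F)) then
    xTilde x ((h.choose.1 : PGL(2, F)) * (h.choose.2 : PGL(2, F)))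
  else 0

/-! ### The induced representations -/

/-- The space `R_θ` of the locally constant functions `f` on `PGL(2, F)` with
`f (g b) = θ (b̄) ‖b̄‖ ^ (1 / 2) f (g)` for upper triangular `b`, where `b̄ = b₁₁ / b₂₂`. -/
def inducedSpace (θ : Fˣ →ₜ* ℂˣ) : Submodule ℂ (PGL(2, F) → ℂ) where
  carrier := {f | IsLocallyConstant f ∧ ∀ (g : PGL(2, F)) (a b : Fˣ) (u : F),
    f (g * Matrix.ProjGenLinGroup.mk (upperTri a b u)) =
      (θ (a / b) : ℂ) * (Real.sqrt (normAbs (a / b)) : ℂ) * f g}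
  add_mem' {_ _} ha hb := by
    refine ⟨ha.1.add hb.1, fun g a b u => ?_⟩
    simp only [Pi.add_apply, ha.2, hb.2]; ring
  zero_mem' := ⟨IsLocallyConstant.const 0, by simp⟩
  smul_mem' c f hf := by
    refine ⟨hf.1.comp (fun z => c • z), fun g a b u => ?_⟩
    simp only [Pi.smul_apply, smul_eq_mul, hf.2]; ring

/-- The representation `π_θ` of `PGL(2, F)` on `R_θ` by left shifts,
`(π_θ (g) f) (h) = f (g⁻¹ h)`. -/
def piTheta (θ : Fˣ →ₜ* ℂˣ) : Representation ℂ PGL(2, F) (inducedSpace θ) where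
  toFun g :=
    { toFun := fun f => ⟨fun h => (f : PGL(2, F) → ℂ) (g⁻¹ * h), by
        refine ⟨f.2.1.comp_continuous (continuous_const.mul continuous_id), fun h a b u => ?_⟩
        simpa only [mul_assoc] using f.2.2 (g⁻¹ * h) a b u⟩
      map_add' := fun _ _ => rfl
      map_smul' := fun _ _ => rfl }
  map_one' := by ext f h; simp
  map_mul' g g' := by ext f h; simp [mul_assoc]

lemma piTheta_apply (θ : Fˣ →ₜ* ℂˣ) (g : PGL(2, F)) (v : inducedSpace θ) (h : PGL(2, F)) :
    (piTheta θ g v : PGL(2, F) → ℂ) h = (v : PGL(2, F) → ℂ) (g⁻¹ * h) := rfl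

/-- A locally constant compactly supported function is invariant under left shifts by the
elements of a neighbourhood of `1`. -/
lemma eventually_left_invariant (f : testFun F) :
    ∀ᶠ u in nhds (1 : PGL(2, F)), ∀ g, (f : PGL(2, F) → ℂ) (u * g) = (f : PGL(2, F) → ℂ) g := by
  have h1 : ∀ᶠ u in nhds (1 : PGL(2, F)), ∀ g ∈ tsupport (f : PGL(2, F) → ℂ),
      (f : PGL(2, F) → ℂ) (u * g) = (f : PGL(2, F) → ℂ) g := by
    refine f.2.2.isCompact.eventually_forall_of_forall_eventually fun g _ => ?_
    have hm : Filter.Tendsto (fun p : PGL(2, F) × PGL(2, F) => p.1 * p.2) (nhds (1, g))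
        (nhds g) := by
      simpa using (continuous_mul (M := PGL(2, F))).tendsto (1, g)
    have hc := (IsLocallyConstant.iff_eventually_eq _).1 f.2.1 g
    filter_upwards [hm.eventually hc, (continuous_snd.tendsto (1, g)).eventually hc] with p h h'
    exact h.trans h'.symm
  have h2 := (continuous_inv (G := PGL(2, F))).tendsto 1
  rw [inv_one] at h2
  filter_upwards [h1, h2.eventually h1] with u hu hu' g
  by_cases hg : g ∈ tsupport (f : PGL(2, F) → ℂ)
  · exact hu g hg
  · by_cases hug : u * g ∈ tsupport (f : PGL(2, F) → ℂ)
    · simpa using (hu' _ hug).symm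
    · rw [image_eq_zero_of_notMem_tsupport hg, image_eq_zero_of_notMem_tsupport hug]

section integrated

variable [MeasurableSpace PGL(2, F)] [BorelSpace PGL(2, F)]
  (dg : Measure PGL(2, F)) [dg.IsHaarMeasure]

lemma integrable_piTheta (θ : Fˣ →ₜ* ℂˣ) (f : testFun F) (v : inducedSpace θ) (h : PGL(2, F)) :
    Integrable (fun g => (f : PGL(2, F) → ℂ) g * (piTheta θ g v : PGL(2, F) → ℂ) h) dg := by
  refine Continuous.integrable_of_hasCompactSupport ?_ (f.2.2.mul_right)
  refine f.2.1.continuous.mul (v.2.1.continuous.comp ?_)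
  exact (continuous_inv.mul continuous_const)

/-- The operator `π_θ (f dg) = ∫ f (g) π_θ (g) dg` on `R_θ`. -/
def piOp (θ : Fˣ →ₜ* ℂˣ) (f : testFun F) : Module.End ℂ (inducedSpace θ) where
  toFun v := ⟨fun h => ∫ g, (f : PGL(2, F) → ℂ) g * (piTheta θ g v : PGL(2, F) → ℂ) h ∂dg, by
    refine ⟨?_, fun h a b u => ?_⟩
    · refine (IsLocallyConstant.iff_eventually_eq _).2 fun h => ?_
      have ht : Filter.Tendsto (fun h' : PGL(2, F) => h' * h⁻¹) (nhds h) (nhds 1) := by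
        simpa using (continuous_mul_const (h⁻¹ : PGL(2, F))).tendsto h
      filter_upwards [ht.eventually (eventually_left_invariant f)] with h' hu
      rw [← integral_mul_left_eq_self _ (h' * h⁻¹)]
      refine integral_congr_ae (Filter.Eventually.of_forall fun g => ?_)
      simp only [piTheta_apply]
      rw [hu]
      congr 2
      group
    · rw [← integral_const_mul]
      refine integral_congr_ae (Filter.Eventually.of_forall fun g => ?_)
      simp only [(piTheta θ g v).2.2]
      ring⟩
  map_add' v w := by
    ext h
    simp only [map_add, Submodule.coe_add, Pi.add_apply, mul_add]
    exact integral_add (integrable_piTheta dg θ f v h) (integrable_piTheta dg θ f w h)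
  map_smul' c v := by
    ext h
    simp only [map_smul, Submodule.coe_smul, Pi.smul_apply, smul_eq_mul, RingHom.id_apply]
    rw [← integral_const_mul]
    congr 1; ext g; ring

end integrated

/-- The trace of a linear operator of finite rank: the trace of its restriction to its range. -/
def finRankTrace {V : Type*} [AddCommGroup V] [Module ℂ V] (A : Module.End ℂ V) : ℂ :=
  LinearMap.trace ℂ (LinearMap.range A)
    (A.restrict (p := LinearMap.range A) (q := LinearMap.range A) fun v _ => ⟨v, rfl⟩)

end PGL2Hecke

end

open PGL2Hecke

noncomputable section

namespace PGL2Hecke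

variable {F : Type*} [Field F] [ValuativeRel F] [TopologicalSpace F] [IsNonarchimedeanLocalField F]

set_option linter.unusedSectionVars false

/-! ### Arithmetic of the local field -/

/-! The spectral side reduces to rank one. In each `π_θ` the vectors on which `Γ_d` acts through
`x̃` form a line, spanned by a function `cellFun θ` supported on `Γ_d B`. An element of the Hecke
algebra maps `R_θ` into this line, so its trace is its eigenvalue `eigen` on that function.
Eigenvalues multiply under convolution, so the trace is a character of the algebra for every `θ`.
Both multiplicity one (`eq_zero_of_notMem_cell`) and the support of Hecke functions
(`mem_pow_of_heckeX_ne_zero`, `upperTri_mem_doubleCoset`) rest on one device. By minimality of `d`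
there is a unit `y` in `U_(d-1)` with `x(y)² ≠ 1`. At a bad point `g` a triangular element `γ` of
`Γ_d` with diagonal entries `y` and `1` satisfies `γ g = g γ'`, where `γ'` has the diagonal entries
exchanged. The two sides then transform by `x(y)` and `x(y)⁻¹`, in one order or the other, and the
function vanishes at `g`. Hecke functions are therefore supported on the double cosets `Γ_d tⁿ Γ_d`,
and the `φ_n` span by compactness. On `φ_n` the integrand defining the eigenvalue is constant on an
open set of positive finite volume and zero elsewhere (`phi_mul_cellFun_inv`), so the eigenvalue is
`c zⁿ` with `c ≠ 0`. A Laurent polynomial that vanishes at every point of `ℂˣ` is zero, and every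
such point is some `θ(ϖ)`. Hence the `φ_n` are linearly independent, the linear map `φ_n ↦ c zⁿ` is
the trace map, and it is multiplicative because its evaluations are. -/

@[simp]
lemma coe_unitsIncl (u : 𝒪[F]ˣ) : ((unitsIncl F u : Fˣ) : F) = ((u : 𝒪[F]) : F) := rfl

@[simp]
lemma coe_unif (ϖ : 𝒪[F]) (hϖ : Irreducible ϖ) : ((unif ϖ hϖ : Fˣ) : F) = (ϖ : F) := rfl

lemma coe_unit_ne_zero (u : 𝒪[F]ˣ) : ((u : 𝒪[F]) : F) ≠ 0 := (unitsIncl F u).ne_zero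

lemma coe_inv_unit (u : 𝒪[F]ˣ) : (((u⁻¹ : 𝒪[F]ˣ) : 𝒪[F]) : F) = ((u : 𝒪[F]) : F)⁻¹ := by
  exact eq_inv_of_mul_eq_one_left (congrArg Subtype.val u.inv_mul)

lemma isUnit_add_of_mem_maximalIdeal (v : 𝒪[F]ˣ) {c : 𝒪[F]} (hc : c ∈ 𝓂[F]) :
    IsUnit ((v : 𝒪[F]) + c) := by
  by_contra hn
  have h1 : (v : 𝒪[F]) + c - c ∈ 𝓂[F] := sub_mem ((IsLocalRing.mem_maximalIdeal _).2 hn) hc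
  rw [add_sub_cancel_right] at h1
  exact (IsLocalRing.mem_maximalIdeal _).1 h1 v.isUnit

lemma isUnit_one_add {c : 𝒪[F]} (hc : c ∈ 𝓂[F]) : IsUnit (1 + c) :=
  isUnit_add_of_mem_maximalIdeal 1 hc

lemma exists_integer_or_inv (a : F) : (∃ e : 𝒪[F], (e : F) = a) ∨
    ∃ e ∈ 𝓂[F], ((e : 𝒪[F]) : F) = a⁻¹ := by
  rcases le_or_gt (ValuativeRel.valuation F a) 1 with h | h
  · exact Or.inl ⟨⟨a, h⟩, rfl⟩
  · have h' : ValuativeRel.valuation F a⁻¹ < 1 := by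
      rw [map_inv₀]
      exact inv_lt_one_of_one_lt₀ h
    refine Or.inr ⟨⟨a⁻¹, h'.le⟩, ?_, rfl⟩
    rw [IsLocalRing.mem_maximalIdeal, mem_nonunits_iff]
    intro hu
    obtain ⟨b, hb⟩ := hu.exists_right_inv
    have h1 : a⁻¹ * (b : F) = 1 := congrArg Subtype.val hb
    have h2 : ValuativeRel.valuation F (a⁻¹ * b) < 1 := by
      rw [map_mul]
      exact mul_lt_one_of_lt_of_le h' b.2
    rw [h1, map_one] at h2
    exact lt_irrefl _ h2

lemma dvd_of_notMem_maximalIdeal_pow {d : ℕ} {e w : 𝒪[F]} (he : e ∉ 𝓂[F] ^ (d + 1))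
    (hw : w ∈ 𝓂[F] ^ d) : e ∣ w := by
  obtain ⟨ϖ, hϖ⟩ := IsDiscreteValuationRing.exists_irreducible 𝒪[F]
  have he0 : e ≠ 0 := fun h => he (h ▸ zero_mem _)
  obtain ⟨n, u, rfl⟩ := IsDiscreteValuationRing.eq_unit_mul_pow_irreducible he0 hϖ
  rw [hϖ.maximalIdeal_eq, Ideal.span_singleton_pow, Ideal.mem_span_singleton] at he hw
  have hn : n ≤ d := by
    by_contra h
    exact he (Dvd.dvd.mul_left (pow_dvd_pow _ (by omega)) _)
  exact (Units.mul_left_dvd.2 (pow_dvd_pow _ hn)).trans hw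

/-- Either `c` is divisible by `a` in the sense of `𝓂 ^ (d + 1)`, or multiplication by `a / c` maps
`𝓂 ^ d` to the ring of integers. -/
lemma mem_pow_or_div_integral (d : ℕ) (a c : F) :
    (∃ e ∈ 𝓂[F] ^ (d + 1), c = (e : 𝒪[F]) * a) ∨
      (c ≠ 0 ∧ ∀ w ∈ 𝓂[F] ^ d, ∃ u : 𝒪[F], (u : F) * c = (w : 𝒪[F]) * a) := by
  rcases eq_or_ne c 0 with rfl | hc
  · exact Or.inl ⟨0, zero_mem _, by simp⟩
  rcases eq_or_ne a 0 with rfl | ha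
  · exact Or.inr ⟨hc, fun w _ => ⟨0, by simp⟩⟩
  rcases exists_integer_or_inv (c / a) with ⟨e, he⟩ | ⟨e, -, he⟩
  · by_cases hmem : e ∈ 𝓂[F] ^ (d + 1)
    · exact Or.inl ⟨e, hmem, by rw [he]; field_simp⟩
    · refine Or.inr ⟨hc, fun w hw => ?_⟩
      obtain ⟨k, rfl⟩ := dvd_of_notMem_maximalIdeal_pow hmem hw
      refine ⟨k, ?_⟩
      push_cast
      rw [he]
      field_simp
  · refine Or.inr ⟨hc, fun w hw => ⟨w * e, ?_⟩⟩
    push_cast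
    rw [he]
    field_simp

lemma eq_integer_mul_or (a b : F) :
    (∃ e : 𝒪[F], b = e * a) ∨ (b ≠ 0 ∧ ∃ e ∈ 𝓂[F], a = ((e : 𝒪[F]) : F) * b) := by
  rcases eq_or_ne a 0 with rfl | ha
  · rcases eq_or_ne b 0 with rfl | hb
    · exact Or.inl ⟨0, by simp⟩
    · exact Or.inr ⟨hb, 0, zero_mem _, by simp⟩
  rcases exists_integer_or_inv (b / a) with ⟨e, he⟩ | ⟨e, he', he⟩
  · exact Or.inl ⟨e, by rw [he]; field_simp⟩
  · rcases eq_or_ne b 0 with rfl | hb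
    · exact Or.inl ⟨0, by simp⟩
    · exact Or.inr ⟨hb, e, he', by rw [he]; field_simp⟩

lemma exists_eq_unit_mul_zpow (ϖ : 𝒪[F]) (hϖ : Irreducible ϖ) (a : Fˣ) :
    ∃ (u : 𝒪[F]ˣ) (n : ℤ), a = unitsIncl F u * unif ϖ hϖ ^ n := by
  have key : ∀ (a : Fˣ) (e : 𝒪[F]), (e : F) = a →
      ∃ (u : 𝒪[F]ˣ) (n : ℤ), a = unitsIncl F u * unif ϖ hϖ ^ n := by
    intro a e he
    have he0 : e ≠ 0 := by
      rintro rfl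
      exact a.ne_zero (by simpa using he.symm)
    obtain ⟨n, u, hu⟩ := IsDiscreteValuationRing.eq_unit_mul_pow_irreducible he0 hϖ
    refine ⟨u, n, Units.ext ?_⟩
    rw [← he, hu]
    simp
  rcases exists_integer_or_inv (a : F) with ⟨e, he⟩ | ⟨e, -, he⟩
  · exact key a e he
  · obtain ⟨u, n, h⟩ := key a⁻¹ e (by simpa using he)
    exact ⟨u⁻¹, -n, by rw [← inv_inv a, h]; simp [mul_comm]⟩

lemma val_mul (a b : Fˣ) : val (a * b) = val a + val b := by
  simp only [val, Units.val_mul, map_mul]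
  rw [WithZero.log_mul (by simp) (by simp)]
  ring

lemma val_unitsIncl (u : 𝒪[F]ˣ) : val (unitsIncl F u) = 0 := by
  have h1 : ∀ u : 𝒪[F]ˣ, ValuativeRel.valuation F ((u : 𝒪[F]) : F) ≤ 1 := fun u => u.1.2
  have h2 : ValuativeRel.valuation F ((u : 𝒪[F]) : F) = 1 := by
    refine le_antisymm (h1 u) ?_
    have := h1 u⁻¹
    rw [coe_inv_unit, map_inv₀] at this
    exact (inv_le_one₀ (zero_lt_iff.2 (by simp))).1 this
  simp [val, h2]

/-- The normalized valuation as a homomorphism. -/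
def valHom : Fˣ →* Multiplicative ℤ where
  toFun a := Multiplicative.ofAdd (val a)
  map_one' := by simp [val]
  map_mul' a b := by rw [val_mul]; rfl

lemma val_zpow (a : Fˣ) (n : ℤ) : val (a ^ n) = n * val a := by
  have := map_zpow (valHom (F := F)) a n
  simpa [valHom] using congrArg Multiplicative.toAdd this

/-- Some element has valuation `1`, and it is a unit times a power of `ϖ`. So `val ϖ` divides `1`,
and it is nonnegative by integrality. -/
lemma val_unif (ϖ : 𝒪[F]) (hϖ : Irreducible ϖ) : val (unif ϖ hϖ) = 1 := by
  have hnonneg : 0 ≤ val (unif ϖ hϖ) := by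
    have h1 : ValuativeRel.valuation F (ϖ : F) ≤ 1 := ϖ.2
    have h2 := (map_le_map_iff (IsNonarchimedeanLocalField.valueGroupWithZeroIsoInt F)).2 h1
    have h3 := (WithZero.log_le_log (by simp [hϖ.ne_zero]) (by simp)).2 h2
    simpa [val] using h3
  obtain ⟨γ, hγ⟩ := (IsNonarchimedeanLocalField.valueGroupWithZeroIsoInt F).surjective
    (WithZero.exp (-1))
  obtain ⟨a, rfl⟩ := ValuativeRel.valuation_surjective γ
  replace hγ : IsNonarchimedeanLocalField.valueGroupWithZeroIsoInt F
    (ValuativeRel.valuation F a) = WithZero.exp (-1) := hγ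
  have ha : a ≠ 0 := by
    rintro rfl
    rw [map_zero, map_zero] at hγ
    exact WithZero.exp_ne_zero hγ.symm
  obtain ⟨u, n, h⟩ := exists_eq_unit_mul_zpow ϖ hϖ (Units.mk0 a ha)
  have h1 : val (Units.mk0 a ha) = 1 := by simp [val, hγ]
  rw [h, val_mul, val_unitsIncl, val_zpow, zero_add] at h1
  rcases Int.eq_one_or_neg_one_of_mul_eq_one' h1 with h' | h' <;> omega

lemma normAbs_mul (a b : Fˣ) : normAbs (a * b) = normAbs a * normAbs b := by
  have : (Nat.card 𝓀[F] : ℝ) ≠ 0 := by exact_mod_cast Nat.card_pos.ne'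
  rw [normAbs, val_mul, neg_add, zpow_add₀ this]
  rfl

lemma normAbs_pos (a : Fˣ) : 0 < normAbs a := by
  have : 0 < (Nat.card 𝓀[F] : ℝ) := by exact_mod_cast Nat.card_pos
  exact zpow_pos this _

lemma normAbs_unitsIncl (u : 𝒪[F]ˣ) : normAbs (unitsIncl F u) = 1 := by
  simp [normAbs, val_unitsIncl]

/-! ### Local triviality of characters -/

instance : T2Space F := by
  let := IsTopologicalAddGroup.rightUniformSpace F
  have := isUniformAddGroup_of_addCommGroup (G := F)
  have : T0Space F := inferInstance
  infer_instance

lemma isOpen_integer : IsOpen (𝒪[F] : Set F) := (ValuativeRel.valuation F).isOpen_integer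

lemma eventually_mem_coe_pow (r : ℕ) :
    ∀ᶠ a in nhds (0 : F), ∃ e ∈ 𝓂[F] ^ r, ((e : 𝒪[F]) : F) = a := by
  have h : IsOpen ((fun e : 𝒪[F] => (e : F)) '' (𝓂[F] ^ r : Ideal 𝒪[F])) :=
    isOpen_integer.isOpenEmbedding_subtypeVal.isOpenMap _
      (IsLocalRing.isOpen_maximalIdeal_pow 𝒪[F] r)
  exact h.mem_nhds ⟨(0 : 𝒪[F]), zero_mem (𝓂[F] ^ r), rfl⟩

/-- The powers of `𝓂` are compact and decreasing, with intersection `0` by Krull's theorem. -/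
lemma exists_pow_subset {U : Set 𝒪[F]} (hU : U ∈ nhds (0 : 𝒪[F])) :
    ∃ r : ℕ, ((𝓂[F] ^ r : Ideal 𝒪[F]) : Set 𝒪[F]) ⊆ U := by
  refine exists_subset_nhds_of_isCompact (V := fun r : ℕ => ((𝓂[F] ^ r : Ideal 𝒪[F]) : Set 𝒪[F]))
    ?_ ?_ ?_
  · exact (antitone_nat_of_succ_le fun n => Ideal.pow_le_pow_right n.le_succ).directed_ge
  · exact fun r => ((Submodule.toAddSubgroup (𝓂[F] ^ r)).isClosed_of_isOpen
      (IsLocalRing.isOpen_maximalIdeal_pow 𝒪[F] r)).isCompact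
  · intro z hz
    have : z ∈ (⨅ r : ℕ, 𝓂[F] ^ r : Ideal 𝒪[F]) := by
      simpa [Submodule.mem_iInf] using hz
    rw [Ideal.iInf_pow_eq_bot_of_isLocalRing _ (Ideal.IsPrime.ne_top inferInstance),
      Ideal.mem_bot] at this
    rwa [this]

/-- The group `ℂˣ` has no small subgroups: each squaring multiplies the distance to `1` by `‖z ^ (2
^ k) + 1‖ ≥ 3 / 2`. -/
lemma eq_one_of_forall_pow_near_one {z : ℂ} (h : ∀ n : ℕ, ‖z ^ n - 1‖ ≤ 1 / 2) : z = 1 := by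
  have key : ∀ k : ℕ, (3 / 2 : ℝ) ^ k * ‖z - 1‖ ≤ ‖z ^ (2 ^ k) - 1‖ := by
    intro k
    induction k with
    | zero => simp
    | succ k ih =>
      have h1 : z ^ (2 ^ (k + 1)) - 1 = (z ^ (2 ^ k) + 1) * (z ^ (2 ^ k) - 1) := by
        rw [pow_succ, pow_mul]; ring
      have h2 : (3 / 2 : ℝ) ≤ ‖z ^ (2 ^ k) + 1‖ := by
        have h3 : (2 : ℂ) = (z ^ (2 ^ k) + 1) - (z ^ (2 ^ k) - 1) := by ring
        have h4 := norm_sub_le (z ^ (2 ^ k) + 1) (z ^ (2 ^ k) - 1)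
        rw [← h3, Complex.norm_ofNat] at h4
        linarith [h (2 ^ k)]
      rw [h1, norm_mul, pow_succ', mul_assoc]
      exact mul_le_mul h2 ih (by positivity) (by positivity)
  by_contra hz
  have hpos : 0 < ‖z - 1‖ := norm_pos_iff.2 (sub_ne_zero.2 hz)
  obtain ⟨k, hk⟩ := pow_unbounded_of_one_lt (1 / ‖z - 1‖) (by norm_num : (1 : ℝ) < 3 / 2)
  rw [div_lt_iff₀ hpos] at hk
  linarith [key k, h (2 ^ k)]

/-- A character of the units of the ring of integers is trivial on some `1 + 𝓂 ^ r`. -/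
lemma exists_forall_eq_one (x : 𝒪[F]ˣ →ₜ* ℂˣ) :
    ∃ r : ℕ, ∀ u : 𝒪[F]ˣ, (u : 𝒪[F]) - 1 ∈ 𝓂[F] ^ r → x u = 1 := by
  have hc : Continuous fun u : 𝒪[F]ˣ => ((x u : ℂˣ) : ℂ) :=
    Units.continuous_val.comp x.continuous_toFun
  have h1 : ∀ᶠ u in nhds (1 : 𝒪[F]ˣ), ‖((x u : ℂˣ) : ℂ) - 1‖ < 1 / 2 := by
    refine (Continuous.tendsto' ((hc.sub continuous_const).norm) 1 0 ?_).eventually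
      (gt_mem_nhds (by norm_num))
    simp
  -- The topology on units is induced by `u ↦ (u, u⁻¹)`, so both `u` and `u⁻¹` have to be kept close
  -- to `1`.
  rw [nhds_induced, Filter.eventually_comap, Units.embedProduct_apply, nhds_prod_eq,
    Filter.eventually_prod_iff] at h1
  obtain ⟨p, hp, q, hq, h⟩ := h1
  have hp' : {e : 𝒪[F] | p (1 + e)} ∈ nhds 0 :=
    (Continuous.tendsto' (continuous_const.add continuous_id) 0 1 (by simp)).eventually hp
  have hq' : {e : 𝒪[F] | q (MulOpposite.op (1 + e))} ∈ nhds 0 :=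
    (Continuous.tendsto' (MulOpposite.continuous_op.comp (continuous_const.add continuous_id)) 0
      (MulOpposite.op 1) (by simp)).eventually hq
  obtain ⟨r, hr⟩ := exists_pow_subset (Filter.inter_mem hp' hq')
  have hnear : ∀ u : 𝒪[F]ˣ, (u : 𝒪[F]) - 1 ∈ 𝓂[F] ^ r → ‖((x u : ℂˣ) : ℂ) - 1‖ < 1 / 2 := by
    intro u hu
    have hu' : ((u⁻¹ : 𝒪[F]ˣ) : 𝒪[F]) - 1 ∈ 𝓂[F] ^ r := by
      have : ((u⁻¹ : 𝒪[F]ˣ) : 𝒪[F]) - 1 = -((u⁻¹ : 𝒪[F]ˣ) : 𝒪[F]) * (u - 1) := by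
        rw [mul_sub, neg_mul, Units.inv_mul]; ring
      rw [this]
      exact Ideal.mul_mem_left _ _ hu
    have ha := (hr hu).1
    have hb := (hr hu').2
    simp only [Set.mem_ofPred_eq, add_sub_cancel] at ha hb
    exact h ha hb u rfl
  refine ⟨r, fun u hu => Units.ext (eq_one_of_forall_pow_near_one fun n => ?_)⟩
  have := hnear (u ^ n) (by
    obtain ⟨k, hk⟩ := sub_one_dvd_pow_sub_one (u : 𝒪[F]) n
    rw [Units.val_pow_eq_pow_val, hk]
    exact Ideal.mul_mem_right _ _ hu)
  rw [map_pow, Units.val_pow_eq_pow_val] at this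
  exact this.le

/-- Local triviality of `x` makes the set defining `depth` nonempty, so the infimum is attained and
is not the default value `0`. -/
lemma sq_eq_one_of_depth (x : 𝒪[F]ˣ →ₜ* ℂˣ) (u : 𝒪[F]ˣ) (hu : (u : 𝒪[F]) - 1 ∈ 𝓂[F] ^ depth x) :
    x u ^ 2 = 1 := by
  have hne : {r : ℕ | ∀ u : 𝒪[F]ˣ, (u : 𝒪[F]) - 1 ∈ 𝓂[F] ^ r → x u ^ 2 = 1}.Nonempty := by
    obtain ⟨r, hr⟩ := exists_forall_eq_one x
    exact ⟨r, fun u hu => by rw [hr u hu, one_pow]⟩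
  exact Nat.sInf_mem hne u hu

lemma depth_pos {x : 𝒪[F]ˣ →ₜ* ℂˣ} (hx : x ^ 2 ≠ 1) : 0 < depth x := by
  refine Nat.pos_of_ne_zero fun h => hx ?_
  ext u
  have := sq_eq_one_of_depth x u (by rw [h, pow_zero, Ideal.one_eq_top]; trivial)
  simpa using congrArg Units.val this

/-- Minimality of the depth; this unit drives every vanishing argument below. For depth `1` the
congruence is empty, since `𝓂 ^ 0` is the whole ring. -/
lemma exists_sq_ne_one {x : 𝒪[F]ˣ →ₜ* ℂˣ} (hx : x ^ 2 ≠ 1) :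
    ∃ u : 𝒪[F]ˣ, (u : 𝒪[F]) - 1 ∈ 𝓂[F] ^ (depth x - 1) ∧ x u ^ 2 ≠ 1 := by
  have h : depth x - 1 < depth x := Nat.sub_lt (depth_pos hx) one_pos
  simpa using Nat.notMem_of_lt_sInf h

/-! ### Extended characters -/

@[simp]
lemma extZero_coe (x : 𝒪[F]ˣ →ₜ* ℂˣ) (u : 𝒪[F]ˣ) : extZero x ((u : 𝒪[F]) : F) = x u := by
  have h : ∃ v : 𝒪[F]ˣ, ((v : 𝒪[F]) : F) = ((u : 𝒪[F]) : F) := ⟨u, rfl⟩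
  rw [extZero, dif_pos h]
  congr 2
  exact Units.ext (Subtype.ext h.choose_spec)

open scoped Classical in
/-- The function `a ↦ θ (a) ‖a‖ ^ (1 / 2)` on `F`, extended by `0`. -/
def chi (θ : Fˣ →ₜ* ℂˣ) (a : F) : ℂ :=
  if h : a ≠ 0 then (θ (Units.mk0 a h) : ℂ) * (Real.sqrt (normAbs (Units.mk0 a h)) : ℂ) else 0

@[simp]
lemma chi_coe (θ : Fˣ →ₜ* ℂˣ) (a : Fˣ) :
    chi θ (a : F) = (θ a : ℂ) * (Real.sqrt (normAbs a) : ℂ) := by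
  simp [chi]

@[simp]
lemma chi_zero (θ : Fˣ →ₜ* ℂˣ) : chi θ 0 = 0 := by simp [chi]

lemma chi_mul (θ : Fˣ →ₜ* ℂˣ) (a b : F) : chi θ (a * b) = chi θ a * chi θ b := by
  rcases eq_or_ne a 0 with rfl | ha
  · simp
  rcases eq_or_ne b 0 with rfl | hb
  · simp
  lift a to Fˣ using ha.isUnit
  lift b to Fˣ using hb.isUnit
  rw [← Units.val_mul]
  simp only [chi_coe]
  rw [normAbs_mul, Real.sqrt_mul (normAbs_pos a).le, map_mul]
  push_cast
  ring

lemma chi_unit {x : 𝒪[F]ˣ →ₜ* ℂˣ} (θ : Theta x) (u : 𝒪[F]ˣ) :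
    chi θ.1 ((u : 𝒪[F]) : F) = x u := by
  rw [← coe_unitsIncl, chi_coe, θ.2, normAbs_unitsIncl]
  simp

/-- Every element of `Fˣ` is uniquely a unit times a power of `ϖ`, so `x` and `z` determine `θ`, and
any `z` is allowed. -/
lemma bijective_theta_unif (ϖ : 𝒪[F]) (hϖ : Irreducible ϖ) (x : 𝒪[F]ˣ →ₜ* ℂˣ) :
    Function.Bijective (fun θ : Theta x => θ.1 (unif ϖ hϖ)) := by
  refine ⟨fun θ θ' h => Subtype.ext ?_, fun z => ?_⟩
  · ext a
    obtain ⟨u, n, rfl⟩ := exists_eq_unit_mul_zpow ϖ hϖ a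
    simp only at h
    simp only [map_mul, map_zpow, θ.2, θ'.2, h]
  · choose U N hUN using exists_eq_unit_mul_zpow (F := F) ϖ hϖ
    have hinj : Function.Injective (unitsIncl F) := by
      intro u v h
      exact Units.ext (Subtype.ext (by simpa using congrArg Units.val h))
    have huniq : ∀ (a : Fˣ) (u : 𝒪[F]ˣ) (n : ℤ), a = unitsIncl F u * unif ϖ hϖ ^ n →
        U a = u ∧ N a = n := by
      intro a u n h
      have h1 := congrArg (val (F := F)) (hUN a)
      have h2 := congrArg (val (F := F)) h
      rw [val_mul, val_unitsIncl, val_zpow, val_unif] at h1 h2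
      have hn : N a = n := by omega
      refine ⟨hinj ?_, hn⟩
      have h3 := (hUN a).symm.trans h
      rw [hn] at h3
      exact mul_right_cancel h3
    let θ₀ : Fˣ →* ℂˣ :=
      { toFun := fun a => x (U a) * z ^ N a
        map_one' := by
          obtain ⟨h1, h2⟩ := huniq 1 1 0 (by simp)
          simp [h1, h2]
        map_mul' := fun a b => by
          obtain ⟨h1, h2⟩ := huniq (a * b) (U a * U b) (N a + N b) (by
            conv_lhs => rw [hUN a, hUN b]
            rw [map_mul, zpow_add, mul_mul_mul_comm])
          rw [h1, h2, map_mul, zpow_add, mul_mul_mul_comm] }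
    have hθ₀ : ∀ u, θ₀ (unitsIncl F u) = x u := by
      intro u
      obtain ⟨h1, h2⟩ := huniq (unitsIncl F u) u 0 (by simp)
      simp [θ₀, h1, h2]
    have hcont : Continuous θ₀ := by
      refine continuous_of_continuousAt_one θ₀ ?_
      obtain ⟨r, hr⟩ := exists_forall_eq_one x
      have hlim : Filter.Tendsto (fun a : Fˣ => (a : F) - 1) (nhds 1) (nhds 0) :=
        Continuous.tendsto' (Units.continuous_val.sub continuous_const) 1 0 (by simp)
      have hev : ∀ᶠ a in nhds (1 : Fˣ), θ₀ a = 1 := by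
        -- The exponent `r + 1` forces `a` to be a unit even when `r = 0`.
        filter_upwards [hlim.eventually (eventually_mem_coe_pow (F := F) (r + 1))]
          with a ⟨e, he, hea⟩
        obtain ⟨u, hu⟩ := isUnit_one_add (Ideal.pow_le_self (Nat.succ_ne_zero r) he)
        have hau : a = unitsIncl F u := by
          ext
          simp [hu, hea]
        rw [hau, hθ₀]
        refine hr u ?_
        rw [hu, add_sub_cancel_left]
        exact Ideal.pow_le_pow_right r.le_succ he
      rw [ContinuousAt, map_one]
      exact tendsto_const_nhds.congr' (hev.mono fun a h => h.symm)
    refine ⟨⟨⟨θ₀, hcont⟩, hθ₀⟩, ?_⟩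
    obtain ⟨h1, h2⟩ := huniq (unif ϖ hϖ) 1 1 (by simp)
    change x (U _) * z ^ N _ = z
    simp [h1, h2]

/-! ### The subgroup `Γ_d` and its character -/

open Matrix.ProjGenLinGroup (mk)

lemma exists_mk (g : PGL(2, F)) : ∃ m : GL (Fin 2) F, mk m = g :=
  Matrix.ProjGenLinGroup.mk_surjective g

lemma GL_mul_apply (m n : GL (Fin 2) F) (i j : Fin 2) :
    (m * n) i j = m i 0 * n 0 j + m i 1 * n 1 j := by
  simp [Matrix.mul_apply, Fin.sum_univ_two]

lemma det_ne_zero (m : GL (Fin 2) F) : m 0 0 * m 1 1 - m 0 1 * m 1 0 ≠ 0 := by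
  have := m.det.ne_zero
  rwa [Matrix.GeneralLinearGroup.val_det_apply, Matrix.det_fin_two] at this

lemma ratio_mk (m : GL (Fin 2) F) :
    ratio (mk m) = m 0 0 ^ 2 / (m 0 0 * m 1 1 - m 0 1 * m 1 0) := by
  rw [← Matrix.det_fin_two]
  rfl

lemma upperTri_entries (a b : Fˣ) (u : F) :
    upperTri a b u 0 0 = a ∧ upperTri a b u 0 1 = u ∧ upperTri a b u 1 0 = 0 ∧
      upperTri a b u 1 1 = b := by
  simp [upperTri]

lemma mem_Gamma_iff {d : ℕ} {γ : PGL(2, F)} : γ ∈ Gamma F d ↔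
    ∃ k : GL (Fin 2) 𝒪[F], k 1 0 ∈ 𝓂[F] ^ d ∧
      mk (Matrix.GeneralLinearGroup.map (Subring.subtype 𝒪[F]) k) = γ :=
  Iff.rfl

lemma mk_mem_Gamma {d : ℕ} {m : GL (Fin 2) F} (a b c e : 𝒪[F]) (ha : m 0 0 = a) (hb : m 0 1 = b)
    (hc : m 1 0 = c) (he : m 1 1 = e) (hdet : IsUnit (a * e - b * c)) (hcd : c ∈ 𝓂[F] ^ d) :
    mk m ∈ Gamma F d := by
  have hdet' : IsUnit (!![a, b; c, e]).det := by rwa [Matrix.det_fin_two_of]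
  refine mem_Gamma_iff.2 ⟨Matrix.GeneralLinearGroup.mk'' _ hdet', by simpa using hcd, ?_⟩
  congr 1
  refine Matrix.GeneralLinearGroup.ext fun i j => ?_
  fin_cases i <;> fin_cases j <;> simp [ha, hb, hc, he]

/-- The elements of `PGL(2, F)` whose lower left entry is the product of the upper left entry and an
element of `𝓂 ^ d`. -/
def cell (d : ℕ) : Set PGL(2, F) :=
  {g | ∃ m : GL (Fin 2) F, mk m = g ∧ ∃ e ∈ 𝓂[F] ^ d, m 1 0 = ((e : 𝒪[F]) : F) * m 0 0}

lemma mk_mem_cell_iff {d : ℕ} {m : GL (Fin 2) F} :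
    mk m ∈ cell d ↔ ∃ e ∈ 𝓂[F] ^ d, m 1 0 = ((e : 𝒪[F]) : F) * m 0 0 := by
  refine ⟨fun ⟨n, hn, e, he, h⟩ => ?_, fun h => ⟨m, rfl, h⟩⟩
  obtain ⟨u, rfl⟩ := Matrix.ProjGenLinGroup.mk_eq_mk_iff.1 hn
  refine ⟨e, he, ?_⟩
  simp only [GL_mul_apply, Matrix.GeneralLinearGroup.coe_scalar, Matrix.scalar_apply]
  simp [h, mul_assoc]

lemma upper_left_ne_zero {m : GL (Fin 2) F} {e : F} (h : m 1 0 = e * m 0 0) : m 0 0 ≠ 0 := by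
  intro h0
  apply det_ne_zero m
  rw [h, h0]
  ring

/-- The upper left entry of `γ g` is `γ₁₁ g₁₁ y` with `y = 1 + γ₁₁⁻¹ γ₁₂ e`. So `ratio` is
multiplicative up to the square of an element of `U_d`, which `x` does not see when `d` is the
depth. This yields at once the character property of `x̃` and the equivariance of `cellFun`. -/
lemma exists_ratio_mul {d : ℕ} (hd : 0 < d) {γ g : PGL(2, F)} (hγ : γ ∈ Gamma F d)
    (hg : g ∈ cell d) : γ * g ∈ cell d ∧ ∃ u y : 𝒪[F]ˣ, (y : 𝒪[F]) - 1 ∈ 𝓂[F] ^ d ∧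
      ratio γ = (u : 𝒪[F]) ∧ ratio (γ * g) = ((u : 𝒪[F]) : F) * ((y : 𝒪[F]) : F) ^ 2 * ratio g := by
  obtain ⟨k, hk, rfl⟩ := mem_Gamma_iff.1 hγ
  obtain ⟨m, rfl, e, he, hm⟩ := hg
  have hm0 := upper_left_ne_zero hm
  have hdetm := det_ne_zero m
  obtain ⟨D, hD⟩ : IsUnit (k 0 0 * k 1 1 - k 0 1 * k 1 0) := by
    rw [← Matrix.det_fin_two]
    exact (Matrix.isUnit_iff_isUnit_det _).1 k.isUnit
  have hmax : ∀ c ∈ 𝓂[F] ^ d, c ∈ 𝓂[F] := fun c hc => Ideal.pow_le_self hd.ne' hc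
  -- Here `d > 0` matters: modulo `𝓂` the determinant is the product of the diagonal entries.
  obtain ⟨p, hp⟩ : IsUnit (k 0 0) := by
    have := isUnit_add_of_mem_maximalIdeal D
      (Ideal.mul_mem_left _ (k 0 1) (hmax _ hk))
    rw [hD, sub_add_cancel] at this
    exact isUnit_of_mul_isUnit_left this
  have hye : ((p⁻¹ : 𝒪[F]ˣ) : 𝒪[F]) * k 0 1 * e ∈ 𝓂[F] ^ d := Ideal.mul_mem_left _ _ he
  obtain ⟨y, hy⟩ := isUnit_one_add (hmax _ hye)
  have hk' : ∀ i j, Matrix.GeneralLinearGroup.map (Subring.subtype 𝒪[F]) k i j = (k i j : F) :=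
    fun i j => rfl
  have hpF : ((k 0 0 : 𝒪[F]) : F) ≠ 0 := hp ▸ coe_unit_ne_zero p
  have hyF : ((y : 𝒪[F]) : F) = 1 + (k 0 0 : F)⁻¹ * k 0 1 * e := by
    rw [hy, ← hp, ← coe_inv_unit]
    rfl
  have hDF : (k 0 0 : F) * k 1 1 - k 0 1 * k 1 0 = (D : 𝒪[F]) := by
    rw [hD]
    rfl
  have hDF0 := coe_unit_ne_zero D
  rw [← map_mul]
  refine ⟨mk_mem_cell_iff.2 ?_, p ^ 2 * D⁻¹, y, ?_, ?_, ?_⟩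
  · refine ⟨((p⁻¹ * y⁻¹ : 𝒪[F]ˣ) : 𝒪[F]) * (k 1 0 + k 1 1 * e),
      Ideal.mul_mem_left _ _ (add_mem hk (Ideal.mul_mem_left _ _ he)), ?_⟩
    have hyF0 := coe_unit_ne_zero y
    rw [GL_mul_apply, GL_mul_apply, hk', hk', hk', hk', hm, Units.val_mul]
    push_cast
    rw [coe_inv_unit, coe_inv_unit]
    have : (k 0 0 : F) * m 0 0 + k 0 1 * (e * m 0 0) = (p : 𝒪[F]) * (y : 𝒪[F]) * m 0 0 := by
      rw [hyF, hp]
      field_simp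
    rw [this]
    have := coe_unit_ne_zero p
    field_simp
  · rw [hy, add_sub_cancel_left]
    exact hye
  · rw [ratio_mk]
    simp only [hk', hDF, Units.val_mul, Units.val_pow_eq_pow_val]
    push_cast
    rw [coe_inv_unit, hp]
    field_simp
  · have hdet : ∀ m n : GL (Fin 2) F, (m * n) 0 0 * (m * n) 1 1 - (m * n) 0 1 * (m * n) 1 0 =
        (m 0 0 * m 1 1 - m 0 1 * m 1 0) * (n 0 0 * n 1 1 - n 0 1 * n 1 0) := by
      intro m n
      simp only [GL_mul_apply]
      ring
    rw [ratio_mk, hdet, ratio_mk]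
    simp only [GL_mul_apply, hk', hDF, Units.val_mul, Units.val_pow_eq_pow_val]
    push_cast
    rw [coe_inv_unit, hp, hyF, hm]
    rw [hm] at hdetm
    field_simp

lemma one_mem_cell (d : ℕ) : (1 : PGL(2, F)) ∈ cell d :=
  ⟨1, rfl, 0, zero_mem _, by simp⟩

lemma ratio_one : ratio (1 : PGL(2, F)) = 1 := by
  rw [← Matrix.ProjGenLinGroup.mk_one, ratio_mk]
  simp

lemma mul_upperTri_mem_cell {d : ℕ} {g : PGL(2, F)} (hg : g ∈ cell d) (a b : Fˣ) (u : F) :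
    g * mk (upperTri a b u) ∈ cell d := by
  obtain ⟨m, rfl, e, he, hm⟩ := hg
  obtain ⟨h1, h2, h3, h4⟩ := upperTri_entries a b u
  rw [← map_mul]
  refine mk_mem_cell_iff.2 ⟨e, he, ?_⟩
  rw [GL_mul_apply, GL_mul_apply, h1, h3, hm]
  ring

lemma mul_upperTri_mem_cell_iff {d : ℕ} {g : PGL(2, F)} (a b : Fˣ) (u : F) :
    g * mk (upperTri a b u) ∈ cell d ↔ g ∈ cell d := by
  refine ⟨fun h => ?_, fun h => mul_upperTri_mem_cell h a b u⟩
  have := mul_upperTri_mem_cell h a⁻¹ b⁻¹ (-(u / (a * b)))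
  rwa [mul_assoc, ← map_mul, show upperTri a b u * upperTri a⁻¹ b⁻¹ (-(u / (a * b))) = 1 by
    obtain ⟨h1, h2, h3, h4⟩ := upperTri_entries a b u
    obtain ⟨h1', h2', h3', h4'⟩ := upperTri_entries a⁻¹ b⁻¹ (-(u / (a * b)))
    refine Matrix.GeneralLinearGroup.ext fun i j => ?_
    rw [GL_mul_apply]
    fin_cases i <;> fin_cases j <;>
      simp [h1, h2, h3, h4, h1', h2', h3', h4']
    field_simp
    ring, map_one, mul_one] at this

lemma ratio_mul_upperTri (g : PGL(2, F)) (a b : Fˣ) (u : F) :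
    ratio (g * mk (upperTri a b u)) = ((a / b : Fˣ) : F) * ratio g := by
  obtain ⟨m, rfl⟩ := exists_mk g
  obtain ⟨h1, h2, h3, h4⟩ := upperTri_entries a b u
  rw [← map_mul, ratio_mk, ratio_mk]
  simp only [GL_mul_apply, h1, h2, h3, h4]
  have := det_ne_zero m
  have h5 : (m 0 0 * (a : F) + m 0 1 * 0) * (m 1 0 * u + m 1 1 * b) -
      (m 0 0 * u + m 0 1 * b) * (m 1 0 * a + m 1 1 * 0) =
      a * b * (m 0 0 * m 1 1 - m 0 1 * m 1 0) := by ring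
  rw [h5, Units.val_div_eq_div_val]
  field_simp
  ring

lemma ratio_diag_mul (g : PGL(2, F)) (s : Fˣ) :
    ratio (mk (upperTri 1 s 0) * g) = (s : F)⁻¹ * ratio g := by
  obtain ⟨m, rfl⟩ := exists_mk g
  obtain ⟨h1, h2, h3, h4⟩ := upperTri_entries 1 s (0 : F)
  rw [← map_mul, ratio_mk, ratio_mk]
  simp only [GL_mul_apply, h1, h2, h3, h4]
  have := det_ne_zero m
  have h5 : (((1 : Fˣ) : F) * m 0 0 + 0 * m 1 0) * (0 * m 0 1 + s * m 1 1) -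
      (((1 : Fˣ) : F) * m 0 1 + 0 * m 1 1) * (0 * m 0 0 + s * m 1 0) =
      s * (m 0 0 * m 1 1 - m 0 1 * m 1 0) := by simp; ring
  rw [h5]
  field_simp
  simp

lemma ratio_mul_diag (g : PGL(2, F)) (s : Fˣ) :
    ratio (g * mk (upperTri 1 s 0)) = (s : F)⁻¹ * ratio g := by
  rw [ratio_mul_upperTri]
  simp

lemma tElt_zpow (ϖ : 𝒪[F]) (hϖ : Irreducible ϖ) (n : ℤ) :
    tElt ϖ hϖ ^ n = mk (upperTri 1 (unif ϖ hϖ ^ n) 0) := by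
  let D : Fˣ →* PGL(2, F) :=
    { toFun := fun s => mk (upperTri 1 s 0)
      map_one' := by
        rw [← map_one mk]
        congr 1
        refine Matrix.GeneralLinearGroup.ext fun i j => ?_
        fin_cases i <;> fin_cases j <;> simp [upperTri]
      map_mul' := fun s t => by
        rw [← map_mul]
        congr 1
        refine Matrix.GeneralLinearGroup.ext fun i j => ?_
        rw [GL_mul_apply]
        fin_cases i <;> fin_cases j <;> simp [upperTri] }
  exact (map_zpow D (unif ϖ hϖ) n).symm

/-! ### The equivariant vector of the induced representation -/

instance (x : 𝒪[F]ˣ →ₜ* ℂˣ) : Nonempty (Theta x) := by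
  obtain ⟨ϖ, hϖ⟩ := IsDiscreteValuationRing.exists_irreducible 𝒪[F]
  exact ⟨((bijective_theta_unif ϖ hϖ x).2 1).choose⟩

open scoped Classical in
/-- The function supported on `Γ_d B` whose values there are given by `θ` and `x̃`. -/
def cellFun {x : 𝒪[F]ˣ →ₜ* ℂˣ} (θ : Theta x) (g : PGL(2, F)) : ℂ :=
  if g ∈ cell (depth x) then chi θ.1 (ratio g) else 0

section

variable {x : 𝒪[F]ˣ →ₜ* ℂˣ}

lemma cellFun_one (θ : Theta x) : cellFun θ 1 = 1 := by
  rw [cellFun, if_pos (one_mem_cell _), ratio_one]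
  simpa using chi_unit θ 1

lemma cellFun_Gamma_mul (hx : x ^ 2 ≠ 1) (θ : Theta x) {γ : PGL(2, F)}
    (hγ : γ ∈ Gamma F (depth x)) (g : PGL(2, F)) :
    cellFun θ (γ * g) = xTilde x γ * cellFun θ g := by
  by_cases hg : g ∈ cell (depth x)
  · obtain ⟨h1, u, y, hy, hu, h2⟩ := exists_ratio_mul (depth_pos hx) hγ hg
    have h3 := congrArg Units.val (sq_eq_one_of_depth x y hy)
    rw [Units.val_pow_eq_pow_val, Units.val_one] at h3
    rw [cellFun, cellFun, if_pos hg, if_pos h1, h2, xTilde, hu, extZero_coe, chi_mul, chi_mul,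
      chi_unit, sq, chi_mul, chi_unit, ← sq, h3, mul_one]
  · have h1 : γ * g ∉ cell (depth x) := by
      intro h
      have := (exists_ratio_mul (depth_pos hx) (inv_mem hγ) h).1
      rw [inv_mul_cancel_left] at this
      exact hg this
    rw [cellFun, cellFun, if_neg hg, if_neg h1, mul_zero]

lemma cellFun_mul_upperTri (θ : Theta x) (g : PGL(2, F)) (a b : Fˣ) (u : F) :
    cellFun θ (g * mk (upperTri a b u)) = chi θ.1 ((a / b : Fˣ) : F) * cellFun θ g := by
  rw [cellFun, cellFun, mul_upperTri_mem_cell_iff, ratio_mul_upperTri, chi_mul]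
  split_ifs <;> simp

lemma cellFun_of_mem_Gamma (hx : x ^ 2 ≠ 1) (θ : Theta x) {γ : PGL(2, F)}
    (hγ : γ ∈ Gamma F (depth x)) : cellFun θ γ = xTilde x γ := by
  simpa [cellFun_one] using cellFun_Gamma_mul hx θ hγ 1

/-- On `Γ_d` the function `cellFun θ` coincides with `x̃` for any `θ`, so this is a case of its
equivariance. -/
lemma xTilde_mul (hx : x ^ 2 ≠ 1) {γ γ' : PGL(2, F)}
    (hγ : γ ∈ Gamma F (depth x)) (hγ' : γ' ∈ Gamma F (depth x)) :
    xTilde x (γ * γ') = xTilde x γ * xTilde x γ' := by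
  obtain ⟨θ⟩ : Nonempty (Theta x) := inferInstance
  rw [← cellFun_of_mem_Gamma hx θ hγ', ← cellFun_of_mem_Gamma hx θ (mul_mem hγ hγ'),
    cellFun_Gamma_mul hx θ hγ]

lemma xTilde_one : xTilde x 1 = 1 := by
  rw [xTilde, ratio_one]
  simpa using extZero_coe x 1

lemma xTilde_mul_inv (hx : x ^ 2 ≠ 1) {γ : PGL(2, F)} (hγ : γ ∈ Gamma F (depth x)) :
    xTilde x γ * xTilde x γ⁻¹ = 1 := by
  rw [← xTilde_mul hx hγ (inv_mem hγ), mul_inv_cancel, xTilde_one]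

lemma xTilde_mk (m : GL (Fin 2) F) (u : 𝒪[F]ˣ)
    (h : m 0 0 ^ 2 = (u : 𝒪[F]) * (m 0 0 * m 1 1 - m 0 1 * m 1 0)) : xTilde x (mk m) = x u := by
  have : ratio (mk m) = ((u : 𝒪[F]) : F) := by
    rw [ratio_mk, h, mul_div_cancel_right₀ _ (det_ne_zero m)]
  rw [xTilde, this, extZero_coe]

/-! ### The functions `φ_n` -/

/-- This makes `φ_n` well defined. Multiplication by `diag(1, s)` on either side scales `ratio` by
`s⁻¹`, so `γ t = t γ'` forces `γ` and `γ'` to have the same `ratio`, hence the same `x̃`. -/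
lemma xTilde_eq_of_double_coset (hx : x ^ 2 ≠ 1) (s : Fˣ) {α β α' β' : PGL(2, F)}
    (hα : α ∈ Gamma F (depth x)) (hβ : β ∈ Gamma F (depth x)) (hα' : α' ∈ Gamma F (depth x))
    (hβ' : β' ∈ Gamma F (depth x))
    (h : α * mk (upperTri 1 s 0) * β = α' * mk (upperTri 1 s 0) * β') :
    xTilde x (α * β) = xTilde x (α' * β') := by
  have h1 : α'⁻¹ * α * mk (upperTri 1 s 0) = mk (upperTri 1 s 0) * (β' * β⁻¹) := by
    rw [mul_assoc, inv_mul_eq_iff_eq_mul, ← mul_assoc, ← mul_assoc, ← h, mul_inv_cancel_right]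
  have h2 : xTilde x (α'⁻¹ * α) = xTilde x (β' * β⁻¹) := by
    have := congrArg ratio h1
    rw [ratio_mul_diag, ratio_diag_mul] at this
    rw [xTilde, xTilde, mul_left_cancel₀ (inv_ne_zero s.ne_zero) this]
  rw [xTilde_mul hx (inv_mem hα') hα, xTilde_mul hx hβ' (inv_mem hβ)] at h2
  rw [xTilde_mul hx hα hβ, xTilde_mul hx hα' hβ']
  linear_combination xTilde x α' * xTilde x β * h2 - xTilde x α * xTilde x β *
    xTilde_mul_inv hx hα' + xTilde x α' * xTilde x β' * xTilde_mul_inv hx hβ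

variable (ϖ : 𝒪[F]) (hϖ : Irreducible ϖ)

lemma phi_apply (hx : x ^ 2 ≠ 1) (n : ℤ) {γ γ' : PGL(2, F)} (hγ : γ ∈ Gamma F (depth x))
    (hγ' : γ' ∈ Gamma F (depth x)) :
    phi x ϖ hϖ n (γ * tElt ϖ hϖ ^ n * γ') = xTilde x (γ * γ') := by
  have h : ∃ p : Gamma F (depth x) × Gamma F (depth x),
      γ * tElt ϖ hϖ ^ n * γ' = (p.1 : PGL(2, F)) * tElt ϖ hϖ ^ n * (p.2 : PGL(2, F)) :=
    ⟨(⟨γ, hγ⟩, ⟨γ', hγ'⟩), rfl⟩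
  rw [phi, dif_pos h]
  have h' := h.choose_spec
  generalize h.choose = p at h' ⊢
  rw [tElt_zpow] at h'
  exact (xTilde_eq_of_double_coset hx _ hγ hγ' p.1.2 p.2.2 h').symm

/-- The double coset `Γ_d tⁿ Γ_d`. -/
def doubleCoset (x : 𝒪[F]ˣ →ₜ* ℂˣ) (ϖ : 𝒪[F]) (hϖ : Irreducible ϖ) (n : ℤ) : Set PGL(2, F) :=
  {g | ∃ γ ∈ Gamma F (depth x), ∃ γ' ∈ Gamma F (depth x), g = γ * tElt ϖ hϖ ^ n * γ'}

lemma Gamma_mul_mem_doubleCoset {n : ℤ} {γ g : PGL(2, F)} (hγ : γ ∈ Gamma F (depth x))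
    (hg : g ∈ doubleCoset x ϖ hϖ n) : γ * g ∈ doubleCoset x ϖ hϖ n := by
  obtain ⟨α, hα, β, hβ, rfl⟩ := hg
  exact ⟨γ * α, mul_mem hγ hα, β, hβ, by simp only [mul_assoc]⟩

lemma mul_Gamma_mem_doubleCoset {n : ℤ} {γ g : PGL(2, F)} (hγ : γ ∈ Gamma F (depth x))
    (hg : g ∈ doubleCoset x ϖ hϖ n) : g * γ ∈ doubleCoset x ϖ hϖ n := by
  obtain ⟨α, hα, β, hβ, rfl⟩ := hg
  exact ⟨α, hα, β * γ, mul_mem hβ hγ, by simp only [mul_assoc]⟩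

lemma phi_eq_zero {n : ℤ} {g : PGL(2, F)} (hg : g ∉ doubleCoset x ϖ hϖ n) :
    phi x ϖ hϖ n g = 0 := by
  rw [phi, dif_neg]
  rintro ⟨p, hp⟩
  exact hg ⟨p.1, p.1.2, p.2, p.2.2, hp⟩

lemma phi_Gamma_mul (hx : x ^ 2 ≠ 1) (n : ℤ) {γ : PGL(2, F)} (hγ : γ ∈ Gamma F (depth x))
    (g : PGL(2, F)) : phi x ϖ hϖ n (γ * g) = xTilde x γ * phi x ϖ hϖ n g := by
  by_cases hg : g ∈ doubleCoset x ϖ hϖ n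
  · obtain ⟨α, hα, β, hβ, rfl⟩ := hg
    rw [phi_apply ϖ hϖ hx n hα hβ, ← mul_assoc, ← mul_assoc,
      phi_apply ϖ hϖ hx n (mul_mem hγ hα) hβ, mul_assoc, xTilde_mul hx hγ (mul_mem hα hβ)]
  · rw [phi_eq_zero ϖ hϖ hg, phi_eq_zero, mul_zero]
    intro h
    exact hg (by simpa using Gamma_mul_mem_doubleCoset ϖ hϖ (inv_mem hγ) h)

lemma phi_mul_Gamma (hx : x ^ 2 ≠ 1) (n : ℤ) {γ : PGL(2, F)} (hγ : γ ∈ Gamma F (depth x))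
    (g : PGL(2, F)) : phi x ϖ hϖ n (g * γ) = xTilde x γ * phi x ϖ hϖ n g := by
  by_cases hg : g ∈ doubleCoset x ϖ hϖ n
  · obtain ⟨α, hα, β, hβ, rfl⟩ := hg
    rw [phi_apply ϖ hϖ hx n hα hβ, mul_assoc (α * _),
      phi_apply ϖ hϖ hx n hα (mul_mem hβ hγ), ← mul_assoc, xTilde_mul hx (mul_mem hα hβ) hγ,
      mul_comm]
  · rw [phi_eq_zero ϖ hϖ hg, phi_eq_zero, mul_zero]
    intro h
    exact hg (by simpa using mul_Gamma_mem_doubleCoset ϖ hϖ (inv_mem hγ) h)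

open scoped Classical in
-- For `g = α tⁿ β` the factor `x̃(α β)` of `φ_n` cancels against `x̃(β⁻¹) x̃(α⁻¹)` from `cellFun`;
-- only the contribution of `tⁿ` is left.
lemma phi_mul_cellFun_inv (hx : x ^ 2 ≠ 1) (θ : Theta x) (n : ℤ) (g : PGL(2, F)) :
    phi x ϖ hϖ n g * cellFun θ g⁻¹ =
      if g ∈ doubleCoset x ϖ hϖ n ∧ g⁻¹ ∈ cell (depth x) then
        chi θ.1 ((unif ϖ hϖ ^ n : Fˣ) : F) else 0 := by
  by_cases hc : g⁻¹ ∈ cell (depth x)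
  swap
  · rw [if_neg fun h => hc h.2, cellFun, if_neg hc, mul_zero]
  by_cases hg : g ∈ doubleCoset x ϖ hϖ n
  swap
  · rw [if_neg fun h => hg h.1, phi_eq_zero ϖ hϖ hg, zero_mul]
  rw [if_pos ⟨hg, hc⟩]
  obtain ⟨α, hα, β, hβ, rfl⟩ := hg
  have h1 : (α * tElt ϖ hϖ ^ n * β)⁻¹ = β⁻¹ * (tElt ϖ hϖ ^ (-n) * α⁻¹) := by
    rw [zpow_neg]
    group
  rw [h1] at hc
  have hc' : tElt ϖ hϖ ^ (-n) * α⁻¹ ∈ cell (depth x) := by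
    simpa using (exists_ratio_mul (depth_pos hx) hβ hc).1
  rw [phi_apply ϖ hϖ hx n hα hβ, h1, cellFun_Gamma_mul hx θ (inv_mem hβ), cellFun, if_pos hc',
    tElt_zpow, ratio_diag_mul, chi_mul, xTilde_mul hx hα hβ]
  have h2 : chi θ.1 (ratio α⁻¹) = xTilde x α⁻¹ := by
    rw [← cellFun_of_mem_Gamma hx θ (inv_mem hα), cellFun, if_pos]
    simpa using (exists_ratio_mul (depth_pos hx) (inv_mem hα) (one_mem_cell _)).1
  rw [h2, zpow_neg, Units.val_inv_eq_inv_val, inv_inv]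
  linear_combination chi θ.1 ((unif ϖ hϖ ^ n : Fˣ) : F) * (xTilde x β * xTilde x β⁻¹ *
    xTilde_mul_inv hx hα + xTilde_mul_inv hx hβ)

end

/-! ### Topology of `Γ_d` -/

section

lemma isOpenMap_mk : IsOpenMap (mk : GL (Fin 2) F → PGL(2, F)) :=
  QuotientGroup.isOpenMap_coe (N := Subgroup.center (GL (Fin 2) F))

lemma continuous_mk : Continuous (mk : GL (Fin 2) F → PGL(2, F)) :=
  QuotientGroup.continuous_mk (N := Subgroup.center (GL (Fin 2) F))

lemma eventually_mem_Gamma (x : 𝒪[F]ˣ →ₜ* ℂˣ) (d : ℕ) :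
    ∀ᶠ g in nhds (1 : PGL(2, F)), g ∈ Gamma F d ∧ xTilde x g = 1 := by
  have hle : nhds (1 : PGL(2, F)) ≤ Filter.map (mk : GL (Fin 2) F → PGL(2, F)) (nhds 1) := by
    simpa using isOpenMap_mk.nhds_le (1 : GL (Fin 2) F)
  refine hle ?_
  rw [Filter.mem_map]
  obtain ⟨r, hr⟩ := exists_forall_eq_one x
  have hlim : ∀ i j : Fin 2, ∀ᶠ m in nhds (1 : GL (Fin 2) F),
      -- In the exponent, `d` serves the lower left entry, `r` the triviality of `x`, and `1` the
      -- invertibility of the diagonal entries and the determinant.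
      ∃ e ∈ 𝓂[F] ^ (d + r + 1), ((e : 𝒪[F]) : F) = m i j - (1 : Matrix (Fin 2) (Fin 2) F) i j := by
    intro i j
    have hc : Continuous fun m : GL (Fin 2) F => m i j - (1 : Matrix (Fin 2) (Fin 2) F) i j :=
      (Units.continuous_val.matrix_elem i j).sub continuous_const
    exact (hc.tendsto' 1 0 (by simp)).eventually (eventually_mem_coe_pow _)
  filter_upwards [hlim 0 0, hlim 0 1, hlim 1 0, hlim 1 1] with m ⟨a, ha, ha'⟩ ⟨b, hb, hb'⟩
    ⟨c, hc, hc'⟩ ⟨e, he, he'⟩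
  simp only [Matrix.one_apply_eq, ne_eq, zero_ne_one, one_ne_zero, not_false_eq_true,
    Matrix.one_apply_ne, sub_zero] at ha' hb' hc' he'
  have h00 : m 0 0 = ((1 + a : 𝒪[F]) : F) := by push_cast; rw [ha']; ring
  have h11 : m 1 1 = ((1 + e : 𝒪[F]) : F) := by push_cast; rw [he']; ring
  have hmax : ∀ c ∈ 𝓂[F] ^ (d + r + 1), c ∈ 𝓂[F] := fun c hc => Ideal.pow_le_self (by omega) hc
  have hdet : (1 + a) * (1 + e) - b * c = 1 + (a + e + e * a - c * b) := by ring
  have hk : a + e + e * a - c * b ∈ 𝓂[F] ^ (d + r + 1) :=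
    sub_mem (add_mem (add_mem ha he) (Ideal.mul_mem_left _ _ ha)) (Ideal.mul_mem_left _ _ hb)
  obtain ⟨D, hD⟩ := isUnit_one_add (hmax _ hk)
  obtain ⟨A, hA⟩ := isUnit_one_add (hmax _ ha)
  refine ⟨mk_mem_Gamma _ _ _ _ h00 hb'.symm hc'.symm h11 ?_
    (Ideal.pow_le_pow_right (by omega) hc), ?_⟩
  · rw [hdet]
    exact isUnit_one_add (hmax _ hk)
  · have hu : x (A ^ 2 * D⁻¹) = 1 := by
      refine hr _ ?_
      have h1 : ((A ^ 2 * D⁻¹ : 𝒪[F]ˣ) : 𝒪[F]) - 1 = (D⁻¹ : 𝒪[F]ˣ) * ((A : 𝒪[F]) ^ 2 - D) := by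
        rw [mul_sub, Units.inv_mul, Units.val_mul, Units.val_pow_eq_pow_val, mul_comm]
      rw [h1, hA, hD]
      refine Ideal.mul_mem_left _ _ (Ideal.pow_le_pow_right (show r ≤ d + r + 1 by omega) ?_)
      rw [show (1 + a) ^ 2 - (1 + (a + e + e * a - c * b)) =
        (2 + a) * a - (a + e + e * a - c * b) by ring]
      exact sub_mem (Ideal.mul_mem_left _ _ ha) hk
    · rw [xTilde_mk m (A ^ 2 * D⁻¹) ?_, hu, Units.val_one]
      have h2 : m 0 0 * m 1 1 - m 0 1 * m 1 0 = ((D : 𝒪[F]) : F) := by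
        rw [hD, ← hdet, h00, h11, ← hb', ← hc']
        push_cast
        ring
      have h3 := coe_unit_ne_zero D
      rw [h2, h00, ← hA, Units.val_mul, Units.val_pow_eq_pow_val]
      push_cast
      rw [coe_inv_unit]
      field_simp

lemma isCompact_Gamma (d : ℕ) : IsCompact (Gamma F d : Set PGL(2, F)) := by
  have : CompactSpace (Matrix (Fin 2) (Fin 2) 𝒪[F]) :=
    inferInstanceAs (CompactSpace (Fin 2 → Fin 2 → 𝒪[F]))
  have hclosed : IsClosed (GammaTilde F d : Set (GL (Fin 2) 𝒪[F])) := by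
    have h1 : IsClosed ((𝓂[F] ^ d : Ideal 𝒪[F]) : Set 𝒪[F]) :=
      (Submodule.toAddSubgroup (𝓂[F] ^ d)).isClosed_of_isOpen
        (IsLocalRing.isOpen_maximalIdeal_pow 𝒪[F] d)
    exact h1.preimage (Units.continuous_val.matrix_elem 1 0)
  have hcont : Continuous (intToPGL (F := F)) := by
    refine continuous_mk.comp (Continuous.units_map _ ?_)
    exact continuous_id.matrix_map continuous_subtype_val
  exact hclosed.isCompact.image hcont

lemma isLocallyConstant_of_Gamma_mul {x : 𝒪[F]ˣ →ₜ* ℂˣ} {f : PGL(2, F) → ℂ}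
    (hf : ∀ γ ∈ Gamma F (depth x), ∀ g, f (γ * g) = xTilde x γ * f g) : IsLocallyConstant f := by
  refine (IsLocallyConstant.iff_eventually_eq _).2 fun g => ?_
  have ht : Filter.Tendsto (fun g' : PGL(2, F) => g' * g⁻¹) (nhds g) (nhds 1) := by
    simpa using (continuous_mul_const (g⁻¹ : PGL(2, F))).tendsto g
  filter_upwards [ht.eventually (eventually_mem_Gamma x (depth x))] with g' hg'
  have := hf _ hg'.1 g
  rwa [hg'.2, one_mul, inv_mul_cancel_right] at this

variable {x : 𝒪[F]ˣ →ₜ* ℂˣ} (ϖ : 𝒪[F]) (hϖ : Irreducible ϖ)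

lemma isCompact_doubleCoset (n : ℤ) : IsCompact (doubleCoset x ϖ hϖ n) := by
  have h := ((isCompact_Gamma (F := F) (depth x)).prod (isCompact_Gamma (depth x))).image
    (f := fun p : PGL(2, F) × PGL(2, F) => p.1 * tElt ϖ hϖ ^ n * p.2)
    ((continuous_fst.mul continuous_const).mul continuous_snd)
  convert! h using 1
  ext g
  constructor
  · rintro ⟨γ, hγ, γ', hγ', rfl⟩
    exact ⟨(γ, γ'), ⟨hγ, hγ'⟩, rfl⟩
  · rintro ⟨⟨γ, γ'⟩, ⟨hγ, hγ'⟩, rfl⟩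
    exact ⟨γ, hγ, γ', hγ', rfl⟩

lemma isOpen_doubleCoset (n : ℤ) : IsOpen (doubleCoset x ϖ hϖ n) := by
  refine isOpen_iff_mem_nhds.2 fun g hg => ?_
  have ht : Filter.Tendsto (fun g' : PGL(2, F) => g' * g⁻¹) (nhds g) (nhds 1) := by
    simpa using (continuous_mul_const (g⁻¹ : PGL(2, F))).tendsto g
  filter_upwards [ht.eventually (eventually_mem_Gamma x (depth x))] with g' hg'
  simpa using Gamma_mul_mem_doubleCoset ϖ hϖ hg'.1 hg

lemma phi_mem_heckeX (hx : x ^ 2 ≠ 1) (n : ℤ) : phi x ϖ hϖ n ∈ heckeX x :=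
  ⟨⟨isLocallyConstant_of_Gamma_mul fun _ hγ g => phi_Gamma_mul ϖ hϖ hx n hγ g,
    HasCompactSupport.intro (isCompact_doubleCoset ϖ hϖ n) fun _ hg => phi_eq_zero ϖ hϖ hg⟩,
    fun _ hγ g => ⟨phi_Gamma_mul ϖ hϖ hx n hγ g, phi_mul_Gamma ϖ hϖ hx n hγ g⟩⟩

/-- The vector of `R_θ` given by `cellFun`. -/
def cellVec (hx : x ^ 2 ≠ 1) (θ : Theta x) : inducedSpace θ.1 :=
  ⟨cellFun θ, isLocallyConstant_of_Gamma_mul fun _ hγ g => cellFun_Gamma_mul hx θ hγ g,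
    fun g a b u => by rw [cellFun_mul_upperTri, chi_coe]⟩

/-! ### Multiplicity one in the induced representation -/

/-- A lower unipotent element of `Γ_d` with entry `e` clears the lower left entry; thus `cell d`
lies in `Γ_d B`. -/
lemma exists_Gamma_mul_upperTri {d : ℕ} {g : PGL(2, F)} (hg : g ∈ cell d) :
    ∃ γ ∈ Gamma F d, ∃ (a b : Fˣ) (u : F), g = γ * mk (upperTri a b u) := by
  obtain ⟨m, rfl, e, he, hm⟩ := hg
  have h0 := upper_left_ne_zero hm
  have hdet := det_ne_zero m
  have h1 : m 1 1 - e * m 0 1 ≠ 0 := by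
    intro h
    apply hdet
    rw [hm]
    linear_combination m 0 0 * h
  let l : GL (Fin 2) F := Matrix.GeneralLinearGroup.mkOfDetNeZero !![1, 0; (e : F), 1] (by simp)
  refine ⟨mk l, mk_mem_Gamma 1 0 e 1 (by simp [l]) (by simp [l]) (by simp [l]) (by simp [l])
    (by simp) he, Units.mk0 _ h0, Units.mk0 _ h1, m 0 1, ?_⟩
  rw [← map_mul]
  congr 1
  refine Matrix.GeneralLinearGroup.ext fun i j => ?_
  rw [GL_mul_apply]
  fin_cases i <;> fin_cases j <;> simp [l, upperTri, hm]

/-- The corner entry on the left is chosen so that the left factor fixes the first column of `m`.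
Its conjugate by `m` is then upper triangular with the eigenvalues `1, y` in the other order. -/
lemma upperTri_mul_eq_mul_upperTri {m : GL (Fin 2) F} (hc : m 1 0 ≠ 0) (y : Fˣ) :
    upperTri y 1 (-((y : F) - 1) * m 0 0 / m 1 0) * m =
      m * upperTri 1 y (-((y : F) - 1) * m 1 1 / m 1 0) := by
  obtain ⟨h1, h2, h3, h4⟩ := upperTri_entries y 1 (-((y : F) - 1) * m 0 0 / m 1 0)
  obtain ⟨h1', h2', h3', h4'⟩ := upperTri_entries 1 y (-((y : F) - 1) * m 1 1 / m 1 0)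
  refine Matrix.GeneralLinearGroup.ext fun i j => ?_
  rw [GL_mul_apply, GL_mul_apply]
  fin_cases i <;> fin_cases j <;>
    simp only [Fin.zero_eta, Fin.mk_one, h1, h2, h3, h4, h1', h2', h3', h4', Units.val_one] <;>
    field_simp <;> ring

/-- Off the cell `m₁₁ / m₂₁` maps `𝓂 ^ (d - 1)` into `𝒪`, so the left factor of
`upperTri_mul_eq_mul_upperTri` lies in `Γ_d`. It acts by `x(y)`, while the right factor acts by
`θ(y⁻¹) = x(y)⁻¹`. -/
lemma eq_zero_of_notMem_cell (hx : x ^ 2 ≠ 1) (θ : Theta x) (w : inducedSpace θ.1)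
    (hw : ∀ γ ∈ Gamma F (depth x), ∀ g,
      (w : PGL(2, F) → ℂ) (γ * g) = xTilde x γ * (w : PGL(2, F) → ℂ) g)
    {g : PGL(2, F)} (hg : g ∉ cell (depth x)) : (w : PGL(2, F) → ℂ) g = 0 := by
  obtain ⟨m, rfl⟩ := exists_mk g
  obtain ⟨y, hy, hxy⟩ := exists_sq_ne_one hx
  have hd : depth x - 1 + 1 = depth x := Nat.sub_add_cancel (depth_pos hx)
  rcases mem_pow_or_div_integral (depth x - 1) (m 0 0) (m 1 0) with h | ⟨hc, h⟩
  · rw [hd] at h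
    exact absurd (mk_mem_cell_iff.2 h) hg
  obtain ⟨u, hu⟩ := h _ (neg_mem hy)
  push_cast at hu
  obtain ⟨h1, h2, h3, h4⟩ := upperTri_entries (unitsIncl F y) 1 (u : F)
  have hγ : mk (upperTri (unitsIncl F y) 1 (u : F)) ∈ Gamma F (depth x) :=
    mk_mem_Gamma y u 0 1 h1 h2 h3 h4 (by simp) (zero_mem _)
  have hval : xTilde x (mk (upperTri (unitsIncl F y) 1 (u : F))) = x y := by
    refine xTilde_mk _ _ ?_
    rw [h1, h2, h3, h4]
    simp [sq]
  have hu' : (u : F) = -(((unitsIncl F y : Fˣ) : F) - 1) * m 0 0 / m 1 0 := by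
    rw [eq_div_iff hc]
    exact hu
  have e1 := hw _ hγ (mk m)
  rw [hu', ← map_mul, upperTri_mul_eq_mul_upperTri hc, map_mul, w.2.2, ← hu', hval, ← chi_coe,
    one_div, ← map_inv, coe_unitsIncl, chi_unit, map_inv] at e1
  by_contra hne
  have e2 := mul_right_cancel₀ hne e1
  rw [Units.val_inj] at e2
  apply hxy
  rw [sq, ← inv_eq_iff_mul_eq_one, e2]

lemma eq_smul_cellVec (hx : x ^ 2 ≠ 1) (θ : Theta x) (w : inducedSpace θ.1)
    (hw : ∀ γ ∈ Gamma F (depth x), ∀ g,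
      (w : PGL(2, F) → ℂ) (γ * g) = xTilde x γ * (w : PGL(2, F) → ℂ) g) :
    w = (w : PGL(2, F) → ℂ) 1 • cellVec hx θ := by
  ext g
  change (w : PGL(2, F) → ℂ) g = (w : PGL(2, F) → ℂ) 1 * cellFun θ g
  by_cases hg : g ∈ cell (depth x)
  · obtain ⟨γ, hγ, a, b, u, rfl⟩ := exists_Gamma_mul_upperTri hg
    rw [hw γ hγ, cellFun_Gamma_mul hx θ hγ, ← one_mul (mk (upperTri a b u)), w.2.2,
      cellFun_mul_upperTri, cellFun_one, chi_coe]
    ring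
  · rw [eq_zero_of_notMem_cell hx θ w hw hg, cellFun, if_neg hg, mul_zero]

lemma finRankTrace_eq {V : Type*} [AddCommGroup V] [Module ℂ V] {A : Module.End ℂ V} {v : V}
    {c : ℂ} (hv : v ≠ 0) (hA : ∀ w, ∃ k : ℂ, A w = k • v) (hc : A v = c • v) :
    finRankTrace A = c := by
  have hle : LinearMap.range A ≤ Submodule.span ℂ {v} := by
    rintro _ ⟨w, rfl⟩
    obtain ⟨k, hk⟩ := hA w
    rw [hk]
    exact Submodule.smul_mem _ _ (Submodule.mem_span_singleton_self v)
  have hscal : A.restrict (p := LinearMap.range A) (q := LinearMap.range A) (fun v _ => ⟨v, rfl⟩) =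
      c • LinearMap.id := by
    ext ⟨w, hw⟩
    obtain ⟨k, rfl⟩ := Submodule.mem_span_singleton.1 (hle hw)
    change A (k • v) = c • k • v
    rw [map_smul, hc, smul_comm]
  have := Submodule.finiteDimensional_of_le hle
  rw [finRankTrace, hscal, map_smul, LinearMap.trace_id]
  -- For `c = 0` the operator may be a nonzero nilpotent, but its restriction to its range is still
  -- zero.
  rcases eq_or_ne c 0 with rfl | hc0
  · simp
  have heq : LinearMap.range A = Submodule.span ℂ {v} := by
    refine le_antisymm hle ((Submodule.span_singleton_le_iff_mem _ _).2 ⟨c⁻¹ • v, ?_⟩)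
    rw [map_smul, hc, inv_smul_smul₀ hc0]
  rw [heq, finrank_span_singleton hv]
  simp

end

/-! ### The operators `π_θ (f dg)` for `f` in the Hecke algebra -/

section

variable [MeasurableSpace PGL(2, F)] [BorelSpace PGL(2, F)]
  (dg : Measure PGL(2, F)) [dg.IsHaarMeasure] {x : 𝒪[F]ˣ →ₜ* ℂˣ}

/-- The eigenvalue of `π_θ (f dg)` on the equivariant vector. -/
def eigen (θ : Theta x) (f : PGL(2, F) → ℂ) : ℂ := ∫ g, f g * cellFun θ g⁻¹ ∂dg

lemma piOp_apply (θ : Theta x) (f : heckeX x) (v : inducedSpace θ.1) (h : PGL(2, F)) :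
    (piOp dg θ.1 (Submodule.inclusion (heckeX_le x) f) v : PGL(2, F) → ℂ) h =
      ∫ g, (f : PGL(2, F) → ℂ) g * (v : PGL(2, F) → ℂ) (g⁻¹ * h) ∂dg := rfl

lemma piOp_Gamma_mul (θ : Theta x) (f : heckeX x) (v : inducedSpace θ.1) {γ : PGL(2, F)}
    (hγ : γ ∈ Gamma F (depth x)) (h : PGL(2, F)) :
    (piOp dg θ.1 (Submodule.inclusion (heckeX_le x) f) v : PGL(2, F) → ℂ) (γ * h) =
      xTilde x γ *
        (piOp dg θ.1 (Submodule.inclusion (heckeX_le x) f) v : PGL(2, F) → ℂ) h := by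
  rw [piOp_apply, piOp_apply, ← integral_mul_left_eq_self _ γ, ← integral_const_mul]
  congr 1
  ext g
  rw [(f.2.2 γ hγ g).1, mul_assoc]
  congr 3
  group

lemma exists_piOp_eq_smul (hx : x ^ 2 ≠ 1) (θ : Theta x) (f : heckeX x) (v : inducedSpace θ.1) :
    ∃ k : ℂ, piOp dg θ.1 (Submodule.inclusion (heckeX_le x) f) v = k • cellVec hx θ :=
  ⟨_, eq_smul_cellVec hx θ _ fun _ hγ h => piOp_Gamma_mul dg θ f v hγ h⟩

lemma piOp_cellVec (hx : x ^ 2 ≠ 1) (θ : Theta x) (f : heckeX x) :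
    piOp dg θ.1 (Submodule.inclusion (heckeX_le x) f) (cellVec hx θ) =
      eigen dg θ f • cellVec hx θ := by
  refine (eq_smul_cellVec hx θ _ fun _ hγ h => piOp_Gamma_mul dg θ f _ hγ h).trans ?_
  rw [piOp_apply]
  simp only [mul_one]
  rfl

lemma finiteDimensional_range_piOp (hx : x ^ 2 ≠ 1) (θ : Theta x) (f : heckeX x) :
    FiniteDimensional ℂ
      (LinearMap.range (piOp dg θ.1 (Submodule.inclusion (heckeX_le x) f))) := by
  refine Submodule.finiteDimensional_of_le (S₂ := Submodule.span ℂ {cellVec hx θ}) ?_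
  rintro _ ⟨w, rfl⟩
  obtain ⟨k, hk⟩ := exists_piOp_eq_smul dg hx θ f w
  rw [hk]
  exact Submodule.smul_mem _ _ (Submodule.mem_span_singleton_self _)

lemma cellVec_ne_zero (hx : x ^ 2 ≠ 1) (θ : Theta x) : cellVec hx θ ≠ 0 := by
  intro h
  have h1 : cellFun θ 1 = 0 := congrFun (congrArg Subtype.val h) 1
  rw [cellFun_one] at h1
  exact one_ne_zero h1

lemma finRankTrace_piOp (hx : x ^ 2 ≠ 1) (θ : Theta x) (f : heckeX x) :
    finRankTrace (piOp dg θ.1 (Submodule.inclusion (heckeX_le x) f)) = eigen dg θ f :=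
  finRankTrace_eq (cellVec_ne_zero hx θ) (exists_piOp_eq_smul dg hx θ f) (piOp_cellVec dg hx θ f)

lemma integral_mul_cellFun (hx : x ^ 2 ≠ 1) (θ : Theta x) (f : heckeX x) (h : PGL(2, F)) :
    ∫ g, (f : PGL(2, F) → ℂ) g * cellFun θ (g⁻¹ * h) ∂dg = eigen dg θ f * cellFun θ h :=
  congrFun (congrArg Subtype.val (piOp_cellVec dg hx θ f)) h

lemma integrable_mul_cellFun_inv (hx : x ^ 2 ≠ 1) (θ : Theta x) (f : heckeX x) :
    Integrable (fun g => (f : PGL(2, F) → ℂ) g * cellFun θ g⁻¹) dg := by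
  have h := integrable_piTheta dg θ.1 (Submodule.inclusion (heckeX_le x) f) (cellVec hx θ) 1
  simp only [piTheta_apply, mul_one] at h
  exact h

/-- The eigenvalue as a linear functional on the Hecke algebra. -/
def eigenHom (hx : x ^ 2 ≠ 1) (θ : Theta x) : heckeX x →ₗ[ℂ] ℂ where
  toFun f := eigen dg θ f
  map_add' f h := by
    rw [eigen, eigen, eigen, ← integral_add (integrable_mul_cellFun_inv dg hx θ f)
      (integrable_mul_cellFun_inv dg hx θ h)]
    simp only [Submodule.coe_add, Pi.add_apply, add_mul]
  map_smul' c f := by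
    simp only [eigen, Submodule.coe_smul, Pi.smul_apply, smul_eq_mul, RingHom.id_apply, mul_assoc]
    rw [integral_const_mul]

/-! ### Convolution -/

lemma conv_mem_heckeX (f h : heckeX x) : conv dg f h ∈ heckeX x := by
  have hl : ∀ γ ∈ Gamma F (depth x), ∀ g, conv dg f h (γ * g) = xTilde x γ * conv dg f h g := by
    intro γ hγ g
    rw [conv, conv, ← integral_mul_left_eq_self _ γ, ← integral_const_mul]
    congr 1
    ext y
    rw [(f.2.2 γ hγ y).1, mul_assoc]
    congr 3
    group
  refine ⟨⟨isLocallyConstant_of_Gamma_mul hl, ?_⟩, fun γ hγ g => ⟨hl γ hγ g, ?_⟩⟩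
  · refine HasCompactSupport.intro (f.2.1.2.isCompact.mul h.2.1.2.isCompact) fun g hg => ?_
    rw [conv]
    refine integral_eq_zero_of_ae (Filter.Eventually.of_forall fun y => ?_)
    by_contra hne
    refine hg (Set.mem_mul.2 ⟨y, subset_tsupport _ (left_ne_zero_of_mul hne), y⁻¹ * g,
      subset_tsupport _ (right_ne_zero_of_mul hne), by group⟩)
  · rw [conv, conv, ← integral_const_mul]
    congr 1
    ext y
    rw [← mul_assoc, (h.2.2 γ hγ _).2]
    ring

/-- After Fubini and the translation `g ↦ y g`, the inner integral is `π_θ(h)` applied to the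
eigenvector and evaluated at `y⁻¹`. -/
lemma eigen_conv (hx : x ^ 2 ≠ 1) (θ : Theta x) (f h : heckeX x) :
    eigen dg θ (conv dg f h) = eigen dg θ f * eigen dg θ h := by
  have hfc : Continuous (f : PGL(2, F) → ℂ) := f.2.1.1.continuous
  have hhc : Continuous (h : PGL(2, F) → ℂ) := h.2.1.1.continuous
  have hvc : Continuous (cellFun θ) := (cellVec hx θ).2.1.continuous
  have hswap := integral_integral_swap_of_hasCompactSupport (μ := dg) (ν := dg)
    (f := fun g y => (f : PGL(2, F) → ℂ) y * (h : PGL(2, F) → ℂ) (y⁻¹ * g) * cellFun θ g⁻¹)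
    (by
      simp only [Function.uncurry_def]
      fun_prop)
    (by
      refine HasCompactSupport.intro ((f.2.1.2.isCompact.mul h.2.1.2.isCompact).prod
        f.2.1.2.isCompact) fun p hp => ?_
      by_contra hne
      have h1 := left_ne_zero_of_mul hne
      have hy := subset_tsupport _ (left_ne_zero_of_mul h1)
      exact hp ⟨Set.mem_mul.2 ⟨p.2, hy, p.2⁻¹ * p.1,
        subset_tsupport _ (right_ne_zero_of_mul h1), by group⟩, hy⟩)
  calc eigen dg θ (conv dg f h)
      = ∫ g, ∫ y, (f : PGL(2, F) → ℂ) y * (h : PGL(2, F) → ℂ) (y⁻¹ * g) *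
          cellFun θ g⁻¹ ∂dg ∂dg := by
        simp only [eigen, conv, integral_mul_const]
    _ = ∫ y, (f : PGL(2, F) → ℂ) y * (eigen dg θ h * cellFun θ y⁻¹) ∂dg := by
        rw [hswap]
        congr 1
        ext y
        simp only [mul_assoc]
        rw [integral_const_mul, ← integral_mul_cellFun dg hx θ h, ← integral_mul_left_eq_self _ y]
        simp only [mul_inv_rev, inv_mul_cancel_left]
    _ = eigen dg θ f * eigen dg θ h := by
        refine Eq.trans ?_ (integral_mul_const _ _)
        congr 1
        ext y
        ring

end

/-! ### The support of the elements of the Hecke algebra -/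

/-- The lower triangular matrix with diagonal `a, b` and lower left entry `u`. -/
def lowerTri (a b : Fˣ) (u : F) : GL (Fin 2) F :=
  Matrix.GeneralLinearGroup.mkOfDetNeZero !![(a : F), 0; u, (b : F)] (by simp)

lemma lowerTri_entries (a b : Fˣ) (u : F) :
    lowerTri a b u 0 0 = a ∧ lowerTri a b u 0 1 = 0 ∧ lowerTri a b u 1 0 = u ∧
      lowerTri a b u 1 1 = b := by
  simp [lowerTri]

/-- The lower triangular analogue of `upperTri_mul_eq_mul_upperTri`: the left factor fixes the
second column. -/
lemma lowerTri_mul_eq_mul_lowerTri (a d y : Fˣ) {b : F} (hb : b ≠ 0) :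
    lowerTri 1 y (-((y : F) - 1) * d / b) * upperTri a d b =
      upperTri a d b * lowerTri y 1 (-((y : F) - 1) * a / b) := by
  obtain ⟨h1, h2, h3, h4⟩ := lowerTri_entries 1 y (-((y : F) - 1) * d / b)
  obtain ⟨h1', h2', h3', h4'⟩ := lowerTri_entries y 1 (-((y : F) - 1) * a / b)
  obtain ⟨k1, k2, k3, k4⟩ := upperTri_entries a d b
  refine Matrix.GeneralLinearGroup.ext fun i j => ?_
  rw [GL_mul_apply, GL_mul_apply]
  fin_cases i <;> fin_cases j <;>
    simp only [Fin.zero_eta, Fin.mk_one, h1, h2, h3, h4, h1', h2', h3', h4', k1, k2, k3, k4,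
      Units.val_one] <;>
    field_simp <;> ring

section

variable {x : 𝒪[F]ˣ →ₜ* ℂˣ}

lemma heckeX_eq_zero (f : heckeX x) {γ γ' g : PGL(2, F)} (hγ : γ ∈ Gamma F (depth x))
    (hγ' : γ' ∈ Gamma F (depth x)) (h : γ * g = g * γ') (hne : xTilde x γ ≠ xTilde x γ') :
    (f : PGL(2, F) → ℂ) g = 0 := by
  by_contra h0
  have h1 := (f.2.2 γ hγ g).1
  rw [h, (f.2.2 γ' hγ' g).2] at h1
  exact hne (mul_right_cancel₀ h0 h1).symm

lemma ne_inv_of_sq_ne_one {y : 𝒪[F]ˣ} (hxy : x y ^ 2 ≠ 1) :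
    ((x y : ℂˣ) : ℂ) ≠ ((x y⁻¹ : ℂˣ) : ℂ) := by
  intro h
  rw [Units.val_inj, map_inv] at h
  exact hxy (by rw [sq, ← eq_inv_iff_mul_eq_one, ← h])

/-- If both alternatives fail, both corner entries in `upperTri_mul_eq_mul_upperTri` are integral.
Both factors then lie in `Γ_d`, with `x̃` equal to `x(y)` and `x(y)⁻¹`. -/
lemma mem_pow_of_heckeX_ne_zero (hx : x ^ 2 ≠ 1) (f : heckeX x) (m : GL (Fin 2) F)
    (hf : (f : PGL(2, F) → ℂ) (mk m) ≠ 0) :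
    (∃ e ∈ 𝓂[F] ^ depth x, m 1 0 = ((e : 𝒪[F]) : F) * m 0 0) ∨
      ∃ e ∈ 𝓂[F] ^ depth x, m 1 0 = ((e : 𝒪[F]) : F) * m 1 1 := by
  obtain ⟨y, hy, hxy⟩ := exists_sq_ne_one hx
  have hd : depth x - 1 + 1 = depth x := Nat.sub_add_cancel (depth_pos hx)
  have key := fun a => mem_pow_or_div_integral (depth x - 1) a (m 1 0)
  rw [hd] at key
  rcases key (m 0 0) with h | ⟨hc, h⟩
  · exact Or.inl h
  rcases key (m 1 1) with h' | ⟨-, h'⟩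
  · exact Or.inr h'
  refine absurd ?_ hf
  obtain ⟨u, hu⟩ := h _ (neg_mem hy)
  obtain ⟨u', hu'⟩ := h' _ (neg_mem hy)
  have e1 : -(((unitsIncl F y : Fˣ) : F) - 1) * m 0 0 / m 1 0 = u := by
    rw [div_eq_iff hc]
    exact hu.symm
  have e2 : -(((unitsIncl F y : Fˣ) : F) - 1) * m 1 1 / m 1 0 = u' := by
    rw [div_eq_iff hc]
    exact hu'.symm
  have hmul := upperTri_mul_eq_mul_upperTri hc (unitsIncl F y)
  rw [e1, e2] at hmul
  obtain ⟨h1, h2, h3, h4⟩ := upperTri_entries (unitsIncl F y) 1 (u : F)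
  obtain ⟨h1', h2', h3', h4'⟩ := upperTri_entries 1 (unitsIncl F y) (u' : F)
  refine heckeX_eq_zero f (mk_mem_Gamma y u 0 1 h1 h2 h3 h4 (by simp) (zero_mem _))
    (mk_mem_Gamma 1 u' 0 y h1' h2' h3' h4' (by simp) (zero_mem _))
    (by rw [← map_mul, ← map_mul, hmul]) ?_
  rw [xTilde_mk _ y (by rw [h1, h2, h3, h4]; simp [sq]),
    xTilde_mk _ y⁻¹ (by
      have := coe_unit_ne_zero y
      rw [h1', h2', h3', h4', coe_inv_unit]
      simp [this])]
  exact ne_inv_of_sq_ne_one hxy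

variable (ϖ : 𝒪[F]) (hϖ : Irreducible ϖ)

lemma mk_diag_mem_doubleCoset (a d : Fˣ) :
    ∃ n : ℤ, mk (upperTri a d 0) ∈ doubleCoset x ϖ hϖ n := by
  obtain ⟨u, n, h⟩ := exists_eq_unit_mul_zpow ϖ hϖ (d / a)
  obtain ⟨h1, h2, h3, h4⟩ := upperTri_entries 1 (unitsIncl F u) (0 : F)
  refine ⟨n, 1, one_mem _, mk (upperTri 1 (unitsIncl F u) 0),
    mk_mem_Gamma 1 0 0 u h1 h2 h3 h4 (by simp) (zero_mem _), ?_⟩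
  rw [one_mul, tElt_zpow, ← map_mul, eq_comm]
  refine Matrix.ProjGenLinGroup.mk_eq_mk_iff.2 ⟨a, ?_⟩
  have hd : (d : F) = ((u : 𝒪[F]) : F) * (unif ϖ hϖ ^ n : Fˣ) * a := by
    rw [div_eq_iff_eq_mul] at h
    exact congrArg Units.val h
  refine Matrix.GeneralLinearGroup.ext fun i j => ?_
  rw [GL_mul_apply, GL_mul_apply, GL_mul_apply]
  fin_cases i <;> fin_cases j <;> simp [upperTri, hd, mul_comm]

/-- If `b` is an integral multiple of `a` or of `d`, an integral unipotent on the right or left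
removes it. Otherwise `a / b` and `d / b` lie in `𝓂`, and `lowerTri_mul_eq_mul_lowerTri` forces `f`
to vanish. -/
lemma upperTri_mem_doubleCoset (hx : x ^ 2 ≠ 1) (f : heckeX x) (a d : Fˣ) (b : F)
    (hf : (f : PGL(2, F) → ℂ) (mk (upperTri a d b)) ≠ 0) :
    ∃ n : ℤ, mk (upperTri a d b) ∈ doubleCoset x ϖ hϖ n := by
  have hN : ∀ e : 𝒪[F], mk (upperTri 1 1 (e : F)) ∈ Gamma F (depth x) := by
    intro e
    obtain ⟨h1, h2, h3, h4⟩ := upperTri_entries 1 1 (e : F)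
    exact mk_mem_Gamma 1 e 0 1 h1 h2 h3 h4 (by simp) (zero_mem _)
  obtain ⟨n, hn⟩ := mk_diag_mem_doubleCoset (x := x) ϖ hϖ a d
  rcases eq_integer_mul_or (a : F) b with ⟨e, rfl⟩ | ⟨hb, e₁, he₁, h1⟩
  · have : upperTri a d ((e : F) * a) = upperTri a d 0 * upperTri 1 1 (e : F) := by
      refine Matrix.GeneralLinearGroup.ext fun i j => ?_
      rw [GL_mul_apply]
      fin_cases i <;> fin_cases j <;> simp [upperTri, mul_comm]
    rw [this, map_mul]
    exact ⟨n, mul_Gamma_mem_doubleCoset ϖ hϖ (hN e) hn⟩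
  rcases eq_integer_mul_or (d : F) b with ⟨e, rfl⟩ | ⟨-, e₂, he₂, h2⟩
  · have : upperTri a d ((e : F) * d) = upperTri 1 1 (e : F) * upperTri a d 0 := by
      refine Matrix.GeneralLinearGroup.ext fun i j => ?_
      rw [GL_mul_apply]
      fin_cases i <;> fin_cases j <;> simp [upperTri]
    rw [this, map_mul]
    exact ⟨n, Gamma_mul_mem_doubleCoset ϖ hϖ (hN e) hn⟩
  refine absurd ?_ hf
  obtain ⟨y, hy, hxy⟩ := exists_sq_ne_one hx
  -- The extra factor in `𝓂` raises `𝓂 ^ (d - 1)` to the `𝓂 ^ d` required of a lower left entry.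
  have hmem : ∀ e ∈ 𝓂[F], -((y : 𝒪[F]) - 1) * e ∈ 𝓂[F] ^ depth x := by
    intro e he
    rw [← Nat.sub_add_cancel (depth_pos hx), pow_succ]
    exact Ideal.mul_mem_mul (neg_mem hy) he
  have hmul := lowerTri_mul_eq_mul_lowerTri a d (unitsIncl F y) hb
  have k1 : -(((unitsIncl F y : Fˣ) : F) - 1) * a / b = ((-((y : 𝒪[F]) - 1) * e₁ : 𝒪[F]) : F) := by
    rw [h1, ← mul_assoc, mul_div_cancel_right₀ _ hb]
    rfl
  have k2 : -(((unitsIncl F y : Fˣ) : F) - 1) * d / b = ((-((y : 𝒪[F]) - 1) * e₂ : 𝒪[F]) : F) := by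
    rw [h2, ← mul_assoc, mul_div_cancel_right₀ _ hb]
    rfl
  rw [k1, k2] at hmul
  obtain ⟨l1, l2, l3, l4⟩ :=
    lowerTri_entries 1 (unitsIncl F y) ((-((y : 𝒪[F]) - 1) * e₂ : 𝒪[F]) : F)
  obtain ⟨l1', l2', l3', l4'⟩ :=
    lowerTri_entries (unitsIncl F y) 1 ((-((y : 𝒪[F]) - 1) * e₁ : 𝒪[F]) : F)
  refine heckeX_eq_zero f (mk_mem_Gamma 1 0 _ y l1 l2 l3 l4 (by simp) (hmem _ he₂))
    (mk_mem_Gamma y 0 _ 1 l1' l2' l3' l4' (by simp) (hmem _ he₁))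
    (by rw [← map_mul, ← map_mul, hmul]) ?_
  rw [xTilde_mk _ y⁻¹ (by
      have := coe_unit_ne_zero y
      rw [l1, l2, l3, l4, coe_inv_unit]
      simp [this]),
    xTilde_mk _ y (by rw [l1', l2', l3', l4']; simp [sq])]
  exact (ne_inv_of_sq_ne_one hxy).symm

lemma exists_mem_doubleCoset (hx : x ^ 2 ≠ 1) (f : heckeX x) (g : PGL(2, F))
    (hf : (f : PGL(2, F) → ℂ) g ≠ 0) : ∃ n : ℤ, g ∈ doubleCoset x ϖ hϖ n := by
  obtain ⟨m, rfl⟩ := exists_mk g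
  rcases mem_pow_of_heckeX_ne_zero hx f m hf with h | ⟨e, he, h⟩
  · obtain ⟨γ, hγ, a, d, b, hm⟩ := exists_Gamma_mul_upperTri (mk_mem_cell_iff.2 h)
    rw [hm, (f.2.2 γ hγ _).1] at hf
    obtain ⟨n, hn⟩ := upperTri_mem_doubleCoset ϖ hϖ hx f a d b (right_ne_zero_of_mul hf)
    exact ⟨n, hm ▸ Gamma_mul_mem_doubleCoset ϖ hϖ hγ hn⟩
  · have hdet := det_ne_zero m
    have h11 : m 1 1 ≠ 0 := by
      intro h0
      apply hdet
      rw [h, h0]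
      ring
    have h00 : m 0 0 - e * m 0 1 ≠ 0 := by
      intro h0
      apply hdet
      rw [h]
      linear_combination m 1 1 * h0
    obtain ⟨h1, h2, h3, h4⟩ := lowerTri_entries 1 1 (e : F)
    have hγ : mk (lowerTri 1 1 (e : F)) ∈ Gamma F (depth x) :=
      mk_mem_Gamma 1 0 e 1 h1 h2 h3 h4 (by simp) he
    have hm : m = upperTri (Units.mk0 _ h00) (Units.mk0 _ h11) (m 0 1) * lowerTri 1 1 (e : F) := by
      refine Matrix.GeneralLinearGroup.ext fun i j => ?_
      rw [GL_mul_apply]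
      fin_cases i <;> fin_cases j <;> simp [upperTri, lowerTri, h, mul_comm]
    rw [hm, map_mul, (f.2.2 _ hγ _).2] at hf
    obtain ⟨n, hn⟩ := upperTri_mem_doubleCoset ϖ hϖ hx f _ _ _ (right_ne_zero_of_mul hf)
    refine ⟨n, ?_⟩
    rw [hm, map_mul]
    exact mul_Gamma_mem_doubleCoset ϖ hϖ hγ hn

/-! ### The functions `φ_n` span the Hecke algebra -/

/-- The function `φ_n` as an element of the Hecke algebra. -/
def phiVec (hx : x ^ 2 ≠ 1) (n : ℤ) : heckeX x := ⟨phi x ϖ hϖ n, phi_mem_heckeX ϖ hϖ hx n⟩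

/-- On `Γ_d tⁿ Γ_d` the function is determined by its value at `tⁿ`, so subtracting `f(tⁿ) φ_n`
removes this coset from the support. Disjointness of the double cosets is not needed. -/
lemma mem_span_phiVec_of_support (hx : x ^ 2 ≠ 1) (S : Finset ℤ) (f : heckeX x)
    (hf : ∀ g, (f : PGL(2, F) → ℂ) g ≠ 0 → ∃ n ∈ S, g ∈ doubleCoset x ϖ hϖ n) :
    f ∈ Submodule.span ℂ (Set.range (phiVec ϖ hϖ hx)) := by
  induction S using Finset.induction_on generalizing f with
  | empty =>
    have : f = 0 := by
      ext g
      by_contra h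
      obtain ⟨n, hn, -⟩ := hf g h
      simp at hn
    rw [this]
    exact zero_mem _
  | insert n S _ ih =>
    set c := (f : PGL(2, F) → ℂ) (tElt ϖ hϖ ^ n) with hc
    have hval : ∀ g, ((f - c • phiVec ϖ hϖ hx n : heckeX x) : PGL(2, F) → ℂ) g =
        (f : PGL(2, F) → ℂ) g - c * phi x ϖ hϖ n g := fun g => rfl
    have hvan : ∀ g ∈ doubleCoset x ϖ hϖ n,
        ((f - c • phiVec ϖ hϖ hx n : heckeX x) : PGL(2, F) → ℂ) g = 0 := by
      rintro _ ⟨γ, hγ, γ', hγ', rfl⟩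
      rw [hval, phi_apply ϖ hϖ hx n hγ hγ', (f.2.2 γ' hγ' _).2, (f.2.2 γ hγ _).1,
        xTilde_mul hx hγ hγ', hc]
      ring
    have hmem : f - c • phiVec ϖ hϖ hx n ∈ Submodule.span ℂ (Set.range (phiVec ϖ hϖ hx)) := by
      refine ih _ fun g hg => ?_
      have hgn : g ∉ doubleCoset x ϖ hϖ n := fun h => hg (hvan g h)
      rw [hval, phi_eq_zero ϖ hϖ hgn, mul_zero, sub_zero] at hg
      obtain ⟨k, hk, hgk⟩ := hf g hg
      rcases Finset.mem_insert.1 hk with rfl | hk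
      · exact absurd hgk hgn
      · exact ⟨k, hk, hgk⟩
    have := add_mem hmem (Submodule.smul_mem _ c (Submodule.subset_span ⟨n, rfl⟩))
    rwa [sub_add_cancel] at this

lemma span_phiVec (hx : x ^ 2 ≠ 1) : ⊤ ≤ Submodule.span ℂ (Set.range (phiVec ϖ hϖ hx)) := by
  intro f _
  have hcl : IsClosed (Function.support (f : PGL(2, F) → ℂ)) :=
    ⟨(Function.compl_support (f := (f : PGL(2, F) → ℂ))).symm ▸ f.2.1.1 {0}⟩
  have hK : IsCompact (Function.support (f : PGL(2, F) → ℂ)) := by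
    have := f.2.1.2.isCompact
    rwa [tsupport, hcl.closure_eq] at this
  obtain ⟨S, hS⟩ := hK.elim_finite_subcover (fun n => doubleCoset x ϖ hϖ n)
    (fun n => isOpen_doubleCoset ϖ hϖ n)
    (fun g hg => Set.mem_iUnion.2 (exists_mem_doubleCoset ϖ hϖ hx f g hg))
  refine mem_span_phiVec_of_support ϖ hϖ hx S f fun g hg => ?_
  simpa using hS hg

end

/-! ### The eigenvalues of `φ_n` -/

section

variable [MeasurableSpace PGL(2, F)] [BorelSpace PGL(2, F)]
  (dg : Measure PGL(2, F)) [dg.IsHaarMeasure] {x : 𝒪[F]ˣ →ₜ* ℂˣ}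
  (ϖ : 𝒪[F]) (hϖ : Irreducible ϖ)

lemma isOpen_cell {d : ℕ} (hd : 0 < d) : IsOpen (cell d : Set PGL(2, F)) := by
  refine isOpen_iff_mem_nhds.2 fun g hg => ?_
  have ht : Filter.Tendsto (fun g' : PGL(2, F) => g' * g⁻¹) (nhds g) (nhds 1) := by
    simpa using (continuous_mul_const (g⁻¹ : PGL(2, F))).tendsto g
  -- Only openness of `Γ_d` matters here, so the trivial character is used.
  filter_upwards [ht.eventually (eventually_mem_Gamma 1 d)] with g' hg'
  simpa using (exists_ratio_mul hd hg'.1 hg).1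

/-- The set on which `φ_n (g)` and the equivariant vector at `g⁻¹` are both nonzero. -/
def phiCell (x : 𝒪[F]ˣ →ₜ* ℂˣ) (n : ℤ) : Set PGL(2, F) :=
  {g | g ∈ doubleCoset x ϖ hϖ n ∧ g⁻¹ ∈ cell (depth x)}

lemma isOpen_phiCell (hx : x ^ 2 ≠ 1) (n : ℤ) : IsOpen (phiCell ϖ hϖ x n) :=
  (isOpen_doubleCoset ϖ hϖ n).inter ((isOpen_cell (depth_pos hx)).preimage continuous_inv)

lemma eigen_phi (hx : x ^ 2 ≠ 1) (θ : Theta x) (n : ℤ) :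
    eigen dg θ (phi x ϖ hϖ n) =
      dg.real (phiCell ϖ hϖ x n) * chi θ.1 ((unif ϖ hϖ ^ n : Fˣ) : F) := by
  classical
  rw [eigen, ← Complex.real_smul,
    ← integral_indicator_const _ (isOpen_phiCell ϖ hϖ hx n).measurableSet]
  congr 1
  ext g
  rw [phi_mul_cellFun_inv ϖ hϖ hx, Set.indicator_apply]
  exact if_congr Iff.rfl rfl rfl

lemma real_phiCell_pos (hx : x ^ 2 ≠ 1) (n : ℤ) : 0 < dg.real (phiCell ϖ hϖ x n) := by
  refine ENNReal.toReal_pos ((isOpen_phiCell ϖ hϖ hx n).measure_pos dg ⟨tElt ϖ hϖ ^ n, ?_, ?_⟩).ne'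
    ((measure_mono fun _ h => h.1).trans_lt (isCompact_doubleCoset ϖ hϖ n).measure_lt_top).ne
  · exact ⟨1, one_mem _, 1, one_mem _, by simp⟩
  · rw [← zpow_neg, tElt_zpow, ← one_mul (mk _)]
    exact mul_upperTri_mem_cell (one_mem_cell _) _ _ _

/-- This identifies the constant of `φ_0` with the volume of `Γ_d`, hence the normalization of the
unit. -/
lemma phiCell_zero (hx : x ^ 2 ≠ 1) : phiCell ϖ hϖ x 0 = Gamma F (depth x) := by
  ext g
  constructor
  · rintro ⟨⟨γ, hγ, γ', hγ', rfl⟩, -⟩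
    simpa using mul_mem hγ hγ'
  · intro hg
    refine ⟨⟨g, hg, 1, one_mem _, by simp⟩, ?_⟩
    simpa using (exists_ratio_mul (depth_pos hx) (inv_mem hg) (one_mem_cell _)).1

/-- The constant `c` such that the eigenvalue of `φ_n` is `c zⁿ`. -/
def phiConst (x : 𝒪[F]ˣ →ₜ* ℂˣ) (n : ℤ) : ℂ :=
  dg.real (phiCell ϖ hϖ x n) * Real.sqrt (normAbs (unif ϖ hϖ ^ n))

lemma phiConst_ne_zero (hx : x ^ 2 ≠ 1) (n : ℤ) : phiConst dg ϖ hϖ x n ≠ 0 := by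
  rw [phiConst, ← Complex.ofReal_mul, Complex.ofReal_ne_zero]
  exact (mul_pos (real_phiCell_pos dg ϖ hϖ hx n) (Real.sqrt_pos.2 (normAbs_pos _))).ne'

lemma phiConst_zero (hx : x ^ 2 ≠ 1) : phiConst dg ϖ hϖ x 0 = dg.real (Gamma F (depth x)) := by
  have : normAbs (1 : Fˣ) = 1 := by simpa using normAbs_unitsIncl (1 : 𝒪[F]ˣ)
  rw [phiConst, phiCell_zero ϖ hϖ hx, zpow_zero, this]
  simp

lemma eigen_phi_eq (hx : x ^ 2 ≠ 1) (θ : Theta x) (n : ℤ) :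
    eigen dg θ (phi x ϖ hϖ n) = phiConst dg ϖ hϖ x n * ((θ.1 (unif ϖ hϖ) ^ n : ℂˣ) : ℂ) := by
  rw [eigen_phi dg ϖ hϖ hx, chi_coe, phiConst, map_zpow]
  ring

end

/-! ### Laurent polynomials -/

/-- Evaluation of Laurent polynomials as a linear functional. -/
def evalLin (z : ℂˣ) : ℂ[T;T⁻¹] →ₗ[ℂ] ℂ where
  toFun := LaurentPolynomial.eval₂ (RingHom.id ℂ) z
  map_add' := map_add _
  map_smul' c p := by simp [LaurentPolynomial.smul_eq_C_mul]

lemma evalLin_apply (z : ℂˣ) (p : ℂ[T;T⁻¹]) :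
    evalLin z p = LaurentPolynomial.eval₂ (RingHom.id ℂ) z p := rfl

lemma eq_zero_of_evalLin_eq_zero {p : ℂ[T;T⁻¹]} (h : ∀ z, evalLin z p = 0) : p = 0 := by
  obtain ⟨n, f, hf⟩ := p.exists_T_pow
  have hroot : ∀ z : ℂˣ, f.eval (z : ℂ) = 0 := by
    intro z
    have h1 := congrArg (LaurentPolynomial.eval₂ (RingHom.id ℂ) z) hf
    rw [map_mul, ← evalLin_apply z p, h z, zero_mul, LaurentPolynomial.eval₂_toLaurent] at h1
    exact h1
  -- The factor `X` takes care of the point `0`, where nothing is known about `f`.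
  have h0 : Polynomial.X * f = 0 := Polynomial.funext fun r => by
    rcases eq_or_ne r 0 with rfl | hr
    · simp
    · have h1 : f.eval r = 0 := hroot (Units.mk0 r hr)
      simp [h1]
  have hf0 : f = 0 := by simpa using h0
  rw [hf0, map_zero] at hf
  exact ((LaurentPolynomial.isUnit_T (n : ℤ)).mul_left_eq_zero).1 hf.symm

/-- The basis of the Laurent polynomials consisting of the multiples `c n • T n`. -/
def laurentBasis {c : ℤ → ℂ} (hc : ∀ n, c n ≠ 0) : Module.Basis ℤ ℂ ℂ[T;T⁻¹] :=
  (AddMonoidAlgebra.basis ℤ ℂ).isUnitSMul fun n => (hc n).isUnit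

lemma laurentBasis_apply {c : ℤ → ℂ} (hc : ∀ n, c n ≠ 0) (n : ℤ) :
    laurentBasis hc n = c n • LaurentPolynomial.T n := by
  rw [laurentBasis, Module.Basis.isUnitSMul_apply]
  rfl

/-! ### The isomorphism -/

section

variable [MeasurableSpace PGL(2, F)] [BorelSpace PGL(2, F)]
  (dg : Measure PGL(2, F)) [dg.IsHaarMeasure] {x : 𝒪[F]ˣ →ₜ* ℂˣ}
  (ϖ : 𝒪[F]) (hϖ : Irreducible ϖ)

lemma evalLin_laurentBasis (hx : x ^ 2 ≠ 1) (θ : Theta x) (n : ℤ) :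
    evalLin (θ.1 (unif ϖ hϖ)) (laurentBasis (phiConst_ne_zero dg ϖ hϖ hx) n) =
      eigenHom dg hx θ (phiVec ϖ hϖ hx n) := by
  rw [laurentBasis_apply, map_smul, evalLin_apply, LaurentPolynomial.eval₂_T, smul_eq_mul]
  exact (eigen_phi_eq dg ϖ hϖ hx θ n).symm

end

/-- The eigenvalues of a combination of the `φ_n` are the values of the corresponding combination of
the `c_n Tⁿ`. A vanishing combination thus gives a Laurent polynomial that is zero on all of `ℂˣ`.
-/
lemma linearIndependent_phiVec [MeasurableSpace PGL(2, F)] [BorelSpace PGL(2, F)]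
    (dg : Measure PGL(2, F)) [dg.IsHaarMeasure] {x : 𝒪[F]ˣ →ₜ* ℂˣ} (ϖ : 𝒪[F])
    (hϖ : Irreducible ϖ) (hx : x ^ 2 ≠ 1) : LinearIndependent ℂ (phiVec ϖ hϖ hx) := by
  rw [linearIndependent_iff]
  intro l hl
  have hB := (laurentBasis (phiConst_ne_zero dg ϖ hϖ hx)).linearIndependent
  refine linearIndependent_iff.1 hB l (eq_zero_of_evalLin_eq_zero fun z => ?_)
  obtain ⟨θ, rfl⟩ := (bijective_theta_unif ϖ hϖ x).2 z
  have hcomp : evalLin (θ.1 (unif ϖ hϖ)) ∘ₗ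
      Finsupp.linearCombination ℂ (laurentBasis (phiConst_ne_zero dg ϖ hϖ hx)) =
      eigenHom dg hx θ ∘ₗ Finsupp.linearCombination ℂ (phiVec ϖ hϖ hx) := by
    ext n
    simpa using evalLin_laurentBasis dg ϖ hϖ hx θ n
  have := LinearMap.congr_fun hcomp l
  rwa [LinearMap.comp_apply, LinearMap.comp_apply, hl, map_zero] at this

section

variable [MeasurableSpace PGL(2, F)] [BorelSpace PGL(2, F)]
  (dg : Measure PGL(2, F)) [dg.IsHaarMeasure] {x : 𝒪[F]ˣ →ₜ* ℂˣ}
  (ϖ : 𝒪[F]) (hϖ : Irreducible ϖ)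

/-- The basis of the Hecke algebra given by the `φ_n`. -/
def phiBasis (hx : x ^ 2 ≠ 1) : Module.Basis ℤ ℂ (heckeX x) :=
  Module.Basis.mk (linearIndependent_phiVec dg ϖ hϖ hx) (span_phiVec ϖ hϖ hx)

lemma phiBasis_apply (hx : x ^ 2 ≠ 1) (n : ℤ) : phiBasis dg ϖ hϖ hx n = phiVec ϖ hϖ hx n :=
  Module.Basis.mk_apply _ _ n

/-- The isomorphism of the Hecke algebra with the Laurent polynomials. -/
def heckeEquiv (hx : x ^ 2 ≠ 1) : heckeX x ≃ₗ[ℂ] ℂ[T;T⁻¹] :=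
  (phiBasis dg ϖ hϖ hx).equiv (laurentBasis (phiConst_ne_zero dg ϖ hϖ hx)) (Equiv.refl ℤ)

lemma heckeEquiv_phiBasis (hx : x ^ 2 ≠ 1) (n : ℤ) :
    heckeEquiv dg ϖ hϖ hx (phiBasis dg ϖ hϖ hx n) =
      phiConst dg ϖ hϖ x n • LaurentPolynomial.T n := by
  rw [heckeEquiv, Module.Basis.equiv_apply, Equiv.refl_apply, laurentBasis_apply]

lemma evalLin_heckeEquiv (hx : x ^ 2 ≠ 1) (θ : Theta x) (f : heckeX x) :
    evalLin (θ.1 (unif ϖ hϖ)) (heckeEquiv dg ϖ hϖ hx f) = eigen dg θ f := by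
  have : evalLin (θ.1 (unif ϖ hϖ)) ∘ₗ (heckeEquiv dg ϖ hϖ hx).toLinearMap = eigenHom dg hx θ := by
    refine (phiBasis dg ϖ hϖ hx).ext fun n => ?_
    rw [LinearMap.comp_apply, LinearEquiv.coe_coe, heckeEquiv_phiBasis, phiBasis_apply,
      ← evalLin_laurentBasis, laurentBasis_apply]
  exact LinearMap.congr_fun this f

/-- Both sides have the same evaluation at each `θ(ϖ)` by `eigen_conv`, and these points exhaust
`ℂˣ`; no structure constants of the `φ_n` are computed. -/
lemma heckeEquiv_conv (hx : x ^ 2 ≠ 1) (f h : heckeX x) :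
    heckeEquiv dg ϖ hϖ hx ⟨conv dg f h, conv_mem_heckeX dg f h⟩ =
      heckeEquiv dg ϖ hϖ hx f * heckeEquiv dg ϖ hϖ hx h := by
  rw [← sub_eq_zero]
  refine eq_zero_of_evalLin_eq_zero fun z => ?_
  obtain ⟨θ, rfl⟩ := (bijective_theta_unif ϖ hϖ x).2 z
  simp only
  rw [map_sub, evalLin_heckeEquiv, evalLin_apply, map_mul, ← evalLin_apply, ← evalLin_apply,
    evalLin_heckeEquiv, evalLin_heckeEquiv, eigen_conv dg hx, sub_self]

lemma heckeEquiv_unit (hx : x ^ 2 ≠ 1) :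
    heckeEquiv dg ϖ hϖ hx
      ((dg.real (Gamma F (depth x) : Set PGL(2, F)) : ℂ)⁻¹ • phiVec ϖ hϖ hx 0) = 1 := by
  rw [map_smul, ← phiBasis_apply dg, heckeEquiv_phiBasis, phiConst_zero dg ϖ hϖ hx, smul_smul,
    inv_mul_cancel₀, one_smul, LaurentPolynomial.T_zero]
  rw [← phiConst_zero dg ϖ hϖ hx]
  exact phiConst_ne_zero dg ϖ hϖ hx 0

end

end PGL2Hecke

end

theorem lemma6p3 {F : Type*} [Field F] [ValuativeRel F] [TopologicalSpace F]
    [IsNonarchimedeanLocalField F] [MeasurableSpace PGL(2, F)] [BorelSpace PGL(2, F)]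
    (dg : Measure PGL(2, F)) [dg.IsHaarMeasure]
    (ϖ : 𝒪[F]) (hϖ : Irreducible ϖ) (x : 𝒪[F]ˣ →ₜ* ℂˣ) (hx : x ^ 2 ≠ 1) :
    -- `θ ↦ θ(ϖ)` identifies `Θ_x` with `ℂˣ`
    Function.Bijective (fun θ : Theta x => θ.1 (unif ϖ hϖ)) ∧
    -- the operators `π_θ(f dg)` have finite rank, so that their traces are defined
    (∀ (θ : Theta x) (f : heckeX x),
      FiniteDimensional ℂ (LinearMap.range (piOp dg θ.1 (Submodule.inclusion (heckeX_le x) f)))) ∧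
    -- `φ_n` takes the prescribed values on its double coset
    (∀ (n : ℤ), ∀ γ ∈ Gamma F (depth x), ∀ γ' ∈ Gamma F (depth x),
      phi x ϖ hϖ n (γ * tElt ϖ hϖ ^ n * γ') = xTilde x (γ * γ')) ∧
    ∃ Φ : heckeX x ≃ₗ[ℂ] ℂ[T;T⁻¹],
      -- `Φ` is the map `μ ↦ (θ ↦ tr π_θ(μ))`
      (∀ (f : heckeX x) (θ : Theta x),
        LaurentPolynomial.eval₂ (RingHom.id ℂ) (θ.1 (unif ϖ hϖ)) (Φ f) =
          finRankTrace (piOp dg θ.1 (Submodule.inclusion (heckeX_le x) f))) ∧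
      -- `Φ` is an isomorphism of unital algebras for the convolution product
      (∀ f h : heckeX x, ∃ hfh : conv dg f h ∈ heckeX x, Φ ⟨conv dg f h, hfh⟩ = Φ f * Φ h) ∧
      (∃ h1 : (fun g => ((dg.real (Gamma F (depth x)) : ℂ))⁻¹ * phi x ϖ hϖ 0 g) ∈ heckeX x,
        Φ ⟨_, h1⟩ = 1) ∧
      -- the elements `μ_n = φ_n dg` form a basis and go to nonzero multiples of `zⁿ`
      ∃ b : Module.Basis ℤ ℂ (heckeX x),
        (∀ n, (b n : PGL(2, F) → ℂ) = phi x ϖ hϖ n) ∧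
        ∀ n, ∃ c : ℂ, c ≠ 0 ∧ Φ (b n) = c • LaurentPolynomial.T n := by
  refine ⟨bijective_theta_unif ϖ hϖ x, finiteDimensional_range_piOp dg hx,
    fun n γ hγ γ' hγ' => phi_apply ϖ hϖ hx n hγ hγ', heckeEquiv dg ϖ hϖ hx, fun f θ => ?_,
    fun f h => ⟨conv_mem_heckeX dg f h, heckeEquiv_conv dg ϖ hϖ hx f h⟩,
    ⟨((dg.real (Gamma F (depth x) : Set PGL(2, F)) : ℂ)⁻¹ • phiVec ϖ hϖ hx 0).2,
      heckeEquiv_unit dg ϖ hϖ hx⟩,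
    phiBasis dg ϖ hϖ hx, fun n => by rw [phiBasis_apply]; rfl,
    fun n => ⟨phiConst dg ϖ hϖ x n, phiConst_ne_zero dg ϖ hϖ hx n,
      heckeEquiv_phiBasis dg ϖ hϖ hx n⟩⟩
  rw [finRankTrace_piOp dg hx, ← evalLin_apply, evalLin_heckeEquiv]
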